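/- Let $R>0$, $\beta>0$, $\Omega:=B_{2R}(0)\setminus\overline{B_R(0)}\subset\mathbb R^2$ and $r(x):=|x|$. Consider the optimal control problem $$\min_{(y,u)\in H^1_0(\Omega)\times BV(\Omega)} J(y,u):=\tfrac12\|y-y_\Omega\|_{L^2(\Omega)}^2+\beta|u|_{BV(\Omega)}\quad\text{s.t.}\quad -\Delta y=u\ \text{in }\Omega,\ y=0\text{ on }\partial\Omega\ \text{(weakly)},\tag{OC}$$ where $|u|_{BV(\Omega)}=\sup\{\int_\Omega u\,\mathrm{div}\,v\,dx:\ v\in C^1_c(\Omega)^2,\ |v|\le1\}$. Put $$\hat h(r):=\tfrac\beta2\bigl(\cos(\tfrac{2\pi}{R}r)-1\bigr),\quad \bar h:=\hat h(r)\nabla r,\quad \bar p:=\mathrm{div}\,\bar h,\quad \bar u:=1_{(R,3R/2)}(r),\quad y_\Omega:=\Delta\bar p+\bar y,$$ and $\bar y(x):=\hat y(r(x))$ with $$\hat y(r)=\begin{cases}-\frac{r^2}4+A\ln\frac r{2R}+B,& R<r<\frac{3R}2,\\ C\ln\frac r{2R},&\frac{3R}2\le r<2R,\end{cases}$$ (extended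 continuously to $r=R$ and $r=2R$), where $$A=\tfrac{R^2}8\cdot\tfrac{18\ln(3/4)-5}{\ln(1/4)},\quad B=\tfrac{9R^2}8\bigl(\tfrac12-\ln\tfrac34\bigr),\quad C=\tfrac{R^2}8\cdot\tfrac{18\ln(3/2)-5}{\ln(1/4)}.$$ Then the following hold. 1. $\bar h$ and $\bar p$ are smooth at every point of $\overline\Omega$, $\bar p=\hat h'(r)+r^{-1}\hat h(r)$ on $\overline\Omega$, and $\bar p=0$ on $\partial\Omega$. 2. $\bar y$ is $C^1$ in $\Omega$, continuous on $\overline\Omega$, zero on $\partial\Omega$, and it is the unique weak solution in $H^1_0(\Omega)$ of $-\Delta y=\bar u$. 3. $y_\Omega\in L^2(\Omega)$, and $\bar p$ is the adjoint state, i.e. the unique weak solution in $H^1_0(\Omega)$ of $-\Delta p=\bar y-y_\Omega$. 4. The first-order optimality conditions hold: for every $q\in[1,\infty)$ the field $\bar h$, with divergence $\bar p$, lies in $W_0^q(\mathrm{div};\Omega)$ (the closure of $C_c^\infty(\Omega)^2$ in the norm $\|v\|_{L^q}+\|\mathrm{div}\,v\|_{L^q}$); $\bar h=0$ on $\partial\Omega$;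 $|\bar h|\le\beta$ in $\Omega$; $\nabla\bar u=-\nabla r\,\mathcal H^1|_{\{r=3R/2\}}$, i.e. $\int_\Omega\bar u\,\mathrm{div}\,v\,dx=\int_{\{r=3R/2\}}v\cdot\nabla r\,d\mathcal H^1$ for all $v\in C_c^1(\Omega)^2$; and $\bar h=-\beta\nabla r$ on the jump set $\{r=3R/2\}$. 5. $(\bar y,\bar u)$ is the unique (up to null sets) global solution of (OC), so that $\bar u$ is the optimal control. 6. The optimal value is $j(\bar u):=J(\bar y,\bar u)=\frac12\|\Delta\bar p\|^2_{L^2(\Omega)}+\beta|\bar u|_{BV(\Omega)}$. For $R=2\pi$ it equals $$\frac{\beta^2\pi}4\Bigl(3\pi^2+\ln 8+\tfrac{15}4\mathrm{Ci}(2\pi)-\tfrac{27}4\mathrm{Ci}(4\pi)+3\,\mathrm{Ci}(8\pi)\Bigr)+6\pi^2\beta\approx 24.85\,\beta^2+59.22\,\beta,$$ where $\mathrm{Ci}(t)=-\int_t^\infty\frac{\cos\tau}\tau\,d\tau$ (a convergent improper integral for $t>0$), and both decimal coefficients are within $0.005$ of the exact ones. -/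

import Mathlib

open MeasureTheory Filter Topology Set
open scoped ENNReal ContDiff

namespace AnnulusControl

noncomputable section

/-! ### Function spaces on an open set `Ω ⊆ ℝᴺ`

Elements of `L²(Ω)`, `H¹₀(Ω)`, `BV(Ω)` are represented by functions on `ℝᴺ`, of which only the
restriction to `Ω`, up to null sets, matters. -/

/-- The divergence `∑ᵢ ∂ᵢ vᵢ` of a vector field. -/
def divergence {N : ℕ} (v : EuclideanSpace ℝ (Fin N) → EuclideanSpace ℝ (Fin N))
    (x : EuclideanSpace ℝ (Fin N)) : ℝ :=
  ∑ i : Fin N, (fderiv ℝ v x (EuclideanSpace.single i 1)) i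

/-- `φ ∈ C_c^k(Ω; F)`. -/
structure IsTest {N : ℕ} {F : Type*} [NormedAddCommGroup F] [NormedSpace ℝ F]
    (k : WithTop ℕ∞) (Ω : Set (EuclideanSpace ℝ (Fin N)))
    (φ : EuclideanSpace ℝ (Fin N) → F) : Prop where
  contDiff : ContDiff ℝ k φ
  hasCompactSupport : HasCompactSupport φ
  tsupport_subset : tsupport φ ⊆ Ω

/-- `|u|_{BV(Ω)} = sup { ∫_Ω u div v : v ∈ C_c^1(Ω)^N, |v| ≤ 1 } ∈ [0, ∞]`
for `u ∈ L¹(Ω)`; the value is nonnegative because `v = 0` is admissible. -/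
def tvSeminorm {N : ℕ} (Ω : Set (EuclideanSpace ℝ (Fin N)))
    (u : EuclideanSpace ℝ (Fin N) → ℝ) : ℝ≥0∞ :=
  ⨆ v ∈ {v : EuclideanSpace ℝ (Fin N) → EuclideanSpace ℝ (Fin N) |
      IsTest 1 Ω v ∧ ∀ x, ‖v x‖ ≤ 1},
    ENNReal.ofReal (∫ x in Ω, u x * divergence v x)

/-- `u ∈ BV(Ω)`. -/
def MemBV {N : ℕ} (Ω : Set (EuclideanSpace ℝ (Fin N)))
    (u : EuclideanSpace ℝ (Fin N) → ℝ) : Prop :=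
  IntegrableOn u Ω ∧ tvSeminorm Ω u < ⊤

/-- `y ∈ H¹₀(Ω)` with weak gradient `g`: the pair `(y, g)` is the limit in `L²(Ω) × L²(Ω)^N` of
`(φₙ, ∇φₙ)` with `φₙ ∈ C_c^∞(Ω)`. -/
structure IsH10 {N : ℕ} (Ω : Set (EuclideanSpace ℝ (Fin N)))
    (y : EuclideanSpace ℝ (Fin N) → ℝ)
    (g : EuclideanSpace ℝ (Fin N) → EuclideanSpace ℝ (Fin N)) : Prop where
  memLp : MemLp y 2 (volume.restrict Ω)
  memLp_grad : MemLp g 2 (volume.restrict Ω)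
  approx : ∃ φ : ℕ → EuclideanSpace ℝ (Fin N) → ℝ, (∀ n, IsTest ∞ Ω (φ n)) ∧
    Tendsto (fun n => eLpNorm (fun x => φ n x - y x) 2 (volume.restrict Ω)) atTop (𝓝 0) ∧
    Tendsto (fun n => eLpNorm (fun x => gradient (φ n) x - g x) 2 (volume.restrict Ω))
      atTop (𝓝 0)

/-- `y ∈ H¹₀(Ω)` is the weak solution of `-Δ y = u` in `Ω`, `y = 0` on `∂Ω`,
for an integrable right-hand side `u`. -/
def IsWeakSolution {N : ℕ} (Ω : Set (EuclideanSpace ℝ (Fin N)))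
    (u y : EuclideanSpace ℝ (Fin N) → ℝ) : Prop :=
  IntegrableOn u Ω ∧ ∃ g : EuclideanSpace ℝ (Fin N) → EuclideanSpace ℝ (Fin N), IsH10 Ω y g ∧
    ∀ φ : EuclideanSpace ℝ (Fin N) → ℝ, IsTest ∞ Ω φ →
      ∫ x in Ω, inner ℝ (g x) (gradient φ x) = ∫ x in Ω, u x * φ x

/-- `h ∈ W₀^q(div; Ω)` with weak divergence `d`: the pair `(h, d)` is the limit in
`L^q(Ω)^N × L^q(Ω)` of `(vₙ, div vₙ)` with `vₙ ∈ C_c^∞(Ω)^N`. -/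
structure IsW0Div {N : ℕ} (q : ℝ≥0∞) (Ω : Set (EuclideanSpace ℝ (Fin N)))
    (h : EuclideanSpace ℝ (Fin N) → EuclideanSpace ℝ (Fin N))
    (d : EuclideanSpace ℝ (Fin N) → ℝ) : Prop where
  memLp : MemLp h q (volume.restrict Ω)
  memLp_div : MemLp d q (volume.restrict Ω)
  approx : ∃ v : ℕ → EuclideanSpace ℝ (Fin N) → EuclideanSpace ℝ (Fin N),
    (∀ n, IsTest ∞ Ω (v n)) ∧
    Tendsto (fun n => eLpNorm (fun x => v n x - h x) q (volume.restrict Ω)) atTop (𝓝 0) ∧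
    Tendsto (fun n => eLpNorm (fun x => divergence (v n) x - d x) q (volume.restrict Ω))
      atTop (𝓝 0)

/-! ### The optimal control problem
`min J(y, u)` over `(y, u) ∈ H¹₀(Ω) × BV(Ω)` subject to `-Δ y = u`. -/

/-- `J(y, u) = ½ ‖y - y_Ω‖²_{L²(Ω)} + β |u|_{BV(Ω)}`. -/
def objective {N : ℕ} (Ω : Set (EuclideanSpace ℝ (Fin N)))
    (yΩ : EuclideanSpace ℝ (Fin N) → ℝ) (β : ℝ)
    (y u : EuclideanSpace ℝ (Fin N) → ℝ) : ℝ :=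
  1 / 2 * (∫ x in Ω, (y x - yΩ x) ^ 2) + β * (tvSeminorm Ω u).toReal

/-- `(y, u) ∈ H¹₀(Ω) × BV(Ω)` and `-Δ y = u`. -/
def Admissible {N : ℕ} (Ω : Set (EuclideanSpace ℝ (Fin N)))
    (y u : EuclideanSpace ℝ (Fin N) → ℝ) : Prop :=
  MemBV Ω u ∧ IsWeakSolution Ω u y

/-- `(y, u)` is a global solution of the optimal control problem. -/
def IsOptimal {N : ℕ} (Ω : Set (EuclideanSpace ℝ (Fin N)))
    (yΩ : EuclideanSpace ℝ (Fin N) → ℝ) (β : ℝ)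
    (y u : EuclideanSpace ℝ (Fin N) → ℝ) : Prop :=
  Admissible Ω y u ∧
    ∀ y' u' : EuclideanSpace ℝ (Fin N) → ℝ, Admissible Ω y' u' →
      objective Ω yΩ β y u ≤ objective Ω yΩ β y' u'

/-! ### The example -/

/-- `Ω = B_{2R}(0) ∖ closure B_R(0)` in `ℝ²`. -/
def annulus (R : ℝ) : Set (EuclideanSpace ℝ (Fin 2)) :=
  Metric.ball 0 (2 * R) \ Metric.closedBall 0 R

/-- `r(x) = |x|`. -/
def radius (x : EuclideanSpace ℝ (Fin 2)) : ℝ := ‖x‖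

/-- `ĥ(r) = β/2 (cos(2πr/R) - 1)`. -/
def hHat (R β r : ℝ) : ℝ := β / 2 * (Real.cos (2 * Real.pi / R * r) - 1)

/-- `h̄ = ĥ(r) ∇r`. -/
def hBar (R β : ℝ) (x : EuclideanSpace ℝ (Fin 2)) : EuclideanSpace ℝ (Fin 2) :=
  hHat R β (radius x) • gradient radius x

/-- `p̄ = div h̄`. -/
def pBar (R β : ℝ) : EuclideanSpace ℝ (Fin 2) → ℝ := divergence (hBar R β)

/-- `ū = 1_{(R, 3R/2)}(r)`. -/
def uBar (R : ℝ) (x : EuclideanSpace ℝ (Fin 2)) : ℝ :=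
  (Ioo R (3 * R / 2)).indicator 1 (radius x)

def constA (R : ℝ) : ℝ := R ^ 2 / 8 * ((18 * Real.log (3 / 4) - 5) / Real.log (1 / 4))

def constB (R : ℝ) : ℝ := 9 * R ^ 2 / 8 * (1 / 2 - Real.log (3 / 4))

def constC (R : ℝ) : ℝ := R ^ 2 / 8 * ((18 * Real.log (3 / 2) - 5) / Real.log (1 / 4))

/-- The radial profile of the optimal state. -/
def yHat (R r : ℝ) : ℝ :=
  if r < 3 * R / 2 then -(r ^ 2 / 4) + constA R * Real.log (r / (2 * R)) + constB R
  else constC R * Real.log (r / (2 * R))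

/-- `ȳ = ŷ(r)`. -/
def yBar (R : ℝ) (x : EuclideanSpace ℝ (Fin 2)) : ℝ := yHat R (radius x)

/-- The desired state `y_Ω = Δ p̄ + ȳ`. -/
def yDesired (R β : ℝ) (x : EuclideanSpace ℝ (Fin 2)) : ℝ :=
  Laplacian.laplacian (pBar R β) x + yBar R x

/-- Arc-length parametrization, up to the speed `ρ`, of the circle of radius `ρ` about `0`. -/
def circlePoint (ρ θ : ℝ) : EuclideanSpace ℝ (Fin 2) :=
  !₂[ρ * Real.cos θ, ρ * Real.sin θ]

/-- The cosine integral `Ci(t) = -∫_t^∞ cos τ / τ dτ` (`t > 0`), an improper integral. -/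
def Ci (t : ℝ) : ℝ := -limUnder atTop (fun T : ℝ => ∫ τ in t..T, Real.cos τ / τ)

/-- The coefficient of `β²` in the optimal value for `R = 2π`. -/
def quadCoeff : ℝ :=
  Real.pi / 4 * (3 * Real.pi ^ 2 + Real.log 8 + 15 / 4 * Ci (2 * Real.pi)
    - 27 / 4 * Ci (4 * Real.pi) + 3 * Ci (8 * Real.pi))

end

end AnnulusControl

open AnnulusControl

/-!
The control problem is convex, so the first-order conditions are sufficient, and the proof is a
calibration argument. Let `(y, u)` be admissible. Expanding the square in the objective,

  `J(y, u) - J(ȳ, ū) = ½ ‖y - ȳ‖² + (y - ȳ, ȳ - y_Ω) + β |u|_BV - β |ū|_BV`.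

Since `ȳ - y_Ω = -Δ p̄`, testing the equation for `y - ȳ` with `p̄` gives
`(y - ȳ, ȳ - y_Ω) = ∫ u p̄ - ∫ ū p̄`. As `p̄ = div h̄` and `h̄` is a limit of test
fields bounded by `β`, one has `∫ u p̄ ≥ -β |u|_BV`. Equality holds for `ū`: by the divergence theorem on the disc of radius `3R/2`, `∫ ū p̄` is the flux of `h̄` through the
jump circle, where `h̄ = -β ∇r`, and `|ū|_BV` is the length of that circle. Hence
`J(y, u) ≥ J(ȳ, ū) + ½ ‖y - ȳ‖²` (`objective_add_le`), which yields optimality, uniqueness of the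
state, and then uniqueness of the control, which is determined by its state
(`isOptimal_bar`).

The functions `p̄` and `ȳ` and the field `h̄` are radial. They are approximated by test functions
by multiplying the radial profile with cutoffs that vanish near `r = R` and `r = 2R`; the profile
vanishes at these radii, so values and gradients converge boundedly and pointwise
(`exists_radial_approx`), which is enough for all limits. The kink of `ŷ'` is approximated in the same
way, because `ŷ - C ln (r / 2R)` vanishes to second order at `r = 3R/2`. The weak equation
for `ȳ` then follows from the divergence theorem on the disc of radius `3R/2`, where the source
term is constant; the divergence theorem itself is proved in polar coordinates. Uniqueness of weak
solutions is the Poincaré inequality.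

For `R = 2π` the optimal value is a one-dimensional integral with an explicit antiderivative, up
to the integrals of `cos r / r` and `cos (2r) / r`, which are differences of values of `Ci`. The
decimal value needs `Ci (4π)` and `Ci (8π)`, for which the asymptotic expansion suffices, and
`Ci (4π) - Ci (2π)`, computed by Taylor expansion of `1 / r` at `3π`.
-/

namespace AnnulusControl

/-! ### Radial functions and vector fields -/

theorem gradient_radius (x : EuclideanSpace ℝ (Fin 2)) : gradient radius x = ‖x‖⁻¹ • x := by
  by_cases hx : x = 0
  · subst hx
    rw [gradient_eq_zero_of_not_differentiableAt]
    · simp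
    · exact not_differentiableAt_norm_zero _
  · have h := (hasStrictFDerivAt_norm_sq x).hasFDerivAt.sqrt (by simpa using hx)
    have h2 : HasGradientAt radius (‖x‖⁻¹ • x) x := by
      rw [hasGradientAt_iff_hasFDerivAt]
      have e : (fun y : EuclideanSpace ℝ (Fin 2) => √(‖y‖ ^ 2)) = radius := by
        funext y; simp [radius, Real.sqrt_sq]
      rw [e] at h
      convert! h using 1
      ext v
      simp
      field_simp
    exact h2.gradient

theorem hasGradientAt_radial {f : ℝ → ℝ} {f' : ℝ} {x : EuclideanSpace ℝ (Fin 2)} (hx : x ≠ 0)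
    (hf : HasDerivAt f f' ‖x‖) :
    HasGradientAt (fun y => f ‖y‖) (f' • gradient radius x) x := by
  have h : HasGradientAt radius (gradient radius x) x :=
    ((contDiffAt_norm (n := 1) ℝ hx).differentiableAt (by simp)).hasGradientAt
  rw [hasGradientAt_iff_hasFDerivAt] at h ⊢
  convert! hf.comp_hasFDerivAt x h using 1
  simp

theorem gradient_radial {f : ℝ → ℝ} {f' : ℝ} {x : EuclideanSpace ℝ (Fin 2)} (hx : x ≠ 0)
    (hf : HasDerivAt f f' ‖x‖) : gradient (fun y => f ‖y‖) x = f' • gradient radius x :=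
  (hasGradientAt_radial hx hf).gradient

/-- The product rule `div (φ G) = φ div G + ∇φ · G`. -/
theorem divergence_smul {N : ℕ} {φ : EuclideanSpace ℝ (Fin N) → ℝ}
    {G : EuclideanSpace ℝ (Fin N) → EuclideanSpace ℝ (Fin N)} {x : EuclideanSpace ℝ (Fin N)}
    (hφ : DifferentiableAt ℝ φ x) (hG : DifferentiableAt ℝ G x) :
    divergence (fun y => φ y • G y) x = φ x * divergence G x + inner ℝ (gradient φ x) (G x) := by
  unfold divergence
  rw [fderiv_fun_smul hφ hG]
  simp only [add_apply, smul_apply,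
    ContinuousLinearMap.smulRight_apply, PiLp.add_apply, PiLp.smul_apply, smul_eq_mul,
    Finset.sum_add_distrib, Finset.mul_sum]
  congr 1
  rw [inner_gradient_left]
  conv_rhs => rw [← (EuclideanSpace.basisFun (Fin N) ℝ).sum_repr (G x)]
  simp [mul_comm]

theorem divergence_id {N : ℕ} (x : EuclideanSpace ℝ (Fin N)) :
    divergence (fun y => y) x = N := by
  simp [divergence]

/-- The divergence of the radial field `k(r) ∇r` in the plane is `k' + k / r`. -/
theorem divergence_radial {k : ℝ → ℝ} {k' : ℝ} {x : EuclideanSpace ℝ (Fin 2)} (hx : x ≠ 0)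
    (hk : HasDerivAt k k' ‖x‖) :
    divergence (fun y => k ‖y‖ • gradient radius y) x = k' + k ‖x‖ / ‖x‖ := by
  have hn : ‖x‖ ≠ 0 := by simpa using hx
  have e : (fun y : EuclideanSpace ℝ (Fin 2) => k ‖y‖ • gradient radius y)
      = fun y => (k ‖y‖ * ‖y‖⁻¹) • y := by
    funext y; rw [gradient_radius, smul_smul]
  have h1 : HasDerivAt (fun r => k r * r⁻¹) (k' * ‖x‖⁻¹ + k ‖x‖ * (-(‖x‖ ^ 2)⁻¹)) ‖x‖ :=
    hk.mul (hasDerivAt_inv hn)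
  have h2 := hasGradientAt_radial hx h1
  rw [e, divergence_smul h2.differentiableAt differentiableAt_fun_id, divergence_id, h2.gradient,
    gradient_radius, inner_smul_left, inner_smul_left, real_inner_self_eq_norm_sq]
  simp
  field_simp
  ring

/-- The Laplacian is the divergence of the gradient. -/
theorem laplacian_eq_divergence_gradient {N : ℕ} {f : EuclideanSpace ℝ (Fin N) → ℝ}
    {x : EuclideanSpace ℝ (Fin N)} (hf : ContDiffAt ℝ 2 f x) :
    Laplacian.laplacian f x = divergence (gradient f) x := by
  rw [congrFun (InnerProductSpace.laplacian_eq_iteratedFDeriv_orthonormalBasis f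
    (EuclideanSpace.basisFun (Fin N) ℝ)) x]
  unfold divergence
  refine Finset.sum_congr rfl fun i _ => ?_
  have hd : DifferentiableAt ℝ (fderiv ℝ f) x :=
    (hf.fderiv_right (m := 1) (by norm_num)).differentiableAt (by simp)
  have hg : DifferentiableAt ℝ (gradient f) x :=
    ((InnerProductSpace.toDual ℝ (EuclideanSpace ℝ (Fin N))).symm.toContinuousLinearEquiv
      |>.toContinuousLinearMap.differentiableAt).comp x hd
  rw [iteratedFDeriv_two_apply]
  simp only [Matrix.cons_val_zero, Matrix.cons_val_one, EuclideanSpace.basisFun_apply]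
  have h1 : ∀ y, (gradient f y) i = fderiv ℝ f y (EuclideanSpace.single i 1) := fun y => by
    rw [← inner_gradient_left, EuclideanSpace.inner_single_right]; simp
  have h2 := (((EuclideanSpace.proj i : EuclideanSpace ℝ (Fin N) →L[ℝ] ℝ).hasFDerivAt).comp x
    hg.hasFDerivAt)
  have h3 := hd.hasFDerivAt.clm_apply (hasFDerivAt_const (EuclideanSpace.single i (1 : ℝ)) x)
  have h4 : ((EuclideanSpace.proj i : EuclideanSpace ℝ (Fin N) →L[ℝ] ℝ) ∘ gradient f)
      = fun y => fderiv ℝ f y (EuclideanSpace.single i (1 : ℝ)) := by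
    funext y; exact h1 y
  rw [h4] at h2
  have h5 := congrArg (fun T => T (EuclideanSpace.single i (1 : ℝ))) (h3.unique h2)
  simpa using h5

theorem laplacian_radial {f f' : ℝ → ℝ} {f'' : ℝ} {x : EuclideanSpace ℝ (Fin 2)} (hx : x ≠ 0)
    (hf : ContDiffAt ℝ 2 f ‖x‖) (hf' : ∀ r, 0 < r → HasDerivAt f (f' r) r)
    (hf'' : HasDerivAt f' f'' ‖x‖) :
    Laplacian.laplacian (fun y : EuclideanSpace ℝ (Fin 2) => f ‖y‖) x
      = f'' + f' ‖x‖ / ‖x‖ := by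
  have hf2 : ContDiffAt ℝ 2 (fun y : EuclideanSpace ℝ (Fin 2) => f ‖y‖) x :=
    hf.comp x (contDiffAt_norm ℝ hx)
  rw [laplacian_eq_divergence_gradient hf2,
    ← divergence_radial hx hf'']
  unfold divergence
  have : gradient (fun y : EuclideanSpace ℝ (Fin 2) => f ‖y‖) =ᶠ[𝓝 x]
      fun y => f' ‖y‖ • gradient radius y := by
    filter_upwards [isOpen_ne.mem_nhds hx] with y hy
    exact gradient_radial hy (hf' _ (norm_pos_iff.2 hy))
  rw [this.fderiv_eq]

/-! ### Integrals of divergences -/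

theorem continuous_divergence {N : ℕ} {v : EuclideanSpace ℝ (Fin N) → EuclideanSpace ℝ (Fin N)}
    (hv : ContDiff ℝ 1 v) : Continuous (divergence v) := by
  unfold divergence
  have := hv.continuous_fderiv (by simp)
  fun_prop

theorem divergence_eq_zero_of_notMem_tsupport {N : ℕ}
    {v : EuclideanSpace ℝ (Fin N) → EuclideanSpace ℝ (Fin N)} {x : EuclideanSpace ℝ (Fin N)}
    (hx : x ∉ tsupport v) : divergence v x = 0 := by
  have : fderiv ℝ v x = 0 := by
    by_contra h
    exact hx (support_fderiv_subset ℝ h)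
  simp [divergence, this]

theorem integral_divergence_eq_zero {N : ℕ}
    {v : EuclideanSpace ℝ (Fin N) → EuclideanSpace ℝ (Fin N)} (hv : ContDiff ℝ 1 v)
    (hc : HasCompactSupport v) : ∫ x, divergence v x = 0 := by
  unfold divergence
  have hcont := hv.continuous_fderiv (by simp)
  have hi : ∀ i, HasCompactSupport fun x => (fderiv ℝ v x (EuclideanSpace.single i 1)) i := by
    intro i
    refine (hc.fderiv (𝕜 := ℝ)).comp_left (g := fun T => (T (EuclideanSpace.single i 1)) i) ?_
    simp
  rw [integral_finsetSum _ fun i _ => (by fun_prop : Continuous _).integrable_of_hasCompactSupport (hi i)]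
  refine Finset.sum_eq_zero fun i _ => ?_
  have hvi : Differentiable ℝ fun x => v x i := by
    have := hv.differentiable (by simp)
    fun_prop
  have hd : ∀ x, fderiv ℝ (fun x => v x i) x (EuclideanSpace.single i 1)
      = (fderiv ℝ v x (EuclideanSpace.single i 1)) i := by
    intro x
    have := ((EuclideanSpace.proj i : EuclideanSpace ℝ (Fin N) →L[ℝ] ℝ).hasFDerivAt).comp x
      ((hv.differentiable (by simp)) x).hasFDerivAt
    exact congrArg (fun T => T (EuclideanSpace.single i (1 : ℝ))) this.fderiv
  have := integral_mul_fderiv_eq_neg_fderiv_mul_of_integrable (𝕜 := ℝ) (μ := volume)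
    (v := EuclideanSpace.single i (1 : ℝ)) (f := fun _ => (1 : ℝ)) (g := fun x => v x i)
    (by simp) ?_ ?_ (by fun_prop) (fun x _ => hvi x)
  · simpa [hd] using this
  · simp only [hd, one_mul]
    exact (by fun_prop : Continuous _).integrable_of_hasCompactSupport (hi i)
  · simp only [one_mul]
    have hv' := hv.continuous
    exact (by fun_prop : Continuous _).integrable_of_hasCompactSupport
      (hc.comp_left (g := fun w : EuclideanSpace ℝ (Fin N) => w i) (by simp))

/-! ### Polar coordinates and the divergence theorem on discs -/

theorem circlePoint_eq (r θ : ℝ) : circlePoint r θ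
    = (r * Real.cos θ) • EuclideanSpace.single 0 1 + (r * Real.sin θ) • EuclideanSpace.single 1 1 := by
  ext i; fin_cases i <;> simp [circlePoint]

theorem norm_circlePoint (r θ : ℝ) : ‖circlePoint r θ‖ = |r| := by
  rw [EuclideanSpace.norm_eq]
  simp only [circlePoint, Fin.sum_univ_two, Real.norm_eq_abs, sq_abs]
  rw [← Real.sqrt_sq_eq_abs]
  congr 1
  simp only [Fin.isValue, Matrix.cons_val_zero, Matrix.cons_val_one]
  linear_combination r ^ 2 * Real.sin_sq_add_cos_sq θ

theorem continuous_circlePoint : Continuous fun p : ℝ × ℝ => circlePoint p.1 p.2 := by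
  simp only [circlePoint_eq]; fun_prop

theorem integral_polar (f : EuclideanSpace ℝ (Fin 2) → ℝ) :
    ∫ x, f x = ∫ p in Ioi (0 : ℝ) ×ˢ Ioo (-Real.pi) Real.pi, p.1 * f (circlePoint p.1 p.2) := by
  have h1 := (PiLp.volume_preserving_toLp (Fin 2)).integral_comp
    (MeasurableEquiv.toLp 2 (Fin 2 → ℝ)).measurableEmbedding f
  have h2 := (volume_preserving_finTwoArrow ℝ).symm.integral_comp
    (MeasurableEquiv.finTwoArrow (α := ℝ)).symm.measurableEmbedding
    (fun y => f (WithLp.toLp 2 y))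
  rw [← h1, ← h2, ← integral_comp_polarCoord_symm, polarCoord_target]
  rfl

/-- **Divergence theorem** on the disc of radius `ρ`, the boundary integral being parametrized by
the angle. -/
theorem integral_ball_divergence {v : EuclideanSpace ℝ (Fin 2) → EuclideanSpace ℝ (Fin 2)}
    (hv : ContDiff ℝ 1 v) {ρ : ℝ} (hρ : 0 < ρ) :
    ∫ x in Metric.ball 0 ρ, divergence v x =
      ∫ θ in (0 : ℝ)..2 * Real.pi, ρ *
        inner ℝ (v (circlePoint ρ θ)) (gradient radius (circlePoint ρ θ)) := by
  -- radial and angular components of the field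
  obtain ⟨a, ha⟩ : ∃ a : ℝ → ℝ → ℝ, a = fun r θ => v (circlePoint r θ) 0 := ⟨_, rfl⟩
  obtain ⟨b, hb⟩ : ∃ b : ℝ → ℝ → ℝ, b = fun r θ => v (circlePoint r θ) 1 := ⟨_, rfl⟩
  obtain ⟨D, hD⟩ : ∃ D : ℝ → ℝ → Fin 2 → Fin 2 → ℝ, D = fun r θ i j =>
    (fderiv ℝ v (circlePoint r θ) (EuclideanSpace.single j 1)) i := ⟨_, rfl⟩
  have hfd : ∀ x, HasFDerivAt v (fderiv ℝ v x) x := fun x =>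
    (hv.differentiable (by simp) x).hasFDerivAt
  have hcr : ∀ i r θ, HasDerivAt (fun s => v (circlePoint s θ) i)
      (Real.cos θ * D r θ i 0 + Real.sin θ * D r θ i 1) r := by
    intro i r θ
    have h1 : HasDerivAt (fun s => circlePoint s θ)
        (Real.cos θ • EuclideanSpace.single 0 1 + Real.sin θ • EuclideanSpace.single 1 1) r := by
      simp only [circlePoint_eq]
      have := (((hasDerivAt_id r).mul_const (Real.cos θ)).smul_const
        (EuclideanSpace.single (0 : Fin 2) (1 : ℝ))).add
        (((hasDerivAt_id r).mul_const (Real.sin θ)).smul_const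
        (EuclideanSpace.single (1 : Fin 2) (1 : ℝ)))
      simp only [one_mul] at this
      exact this
    have h2 := ((EuclideanSpace.proj i : EuclideanSpace ℝ (Fin 2) →L[ℝ] ℝ).hasFDerivAt).comp_hasDerivAt r
      ((hfd _).comp_hasDerivAt r h1)
    simpa [hD, Function.comp_def] using h2
  have hct : ∀ i r θ, HasDerivAt (fun t => v (circlePoint r t) i)
      (-(r * Real.sin θ) * D r θ i 0 + r * Real.cos θ * D r θ i 1) θ := by
    intro i r θ
    have h1 : HasDerivAt (fun t => circlePoint r t)
        ((r * -Real.sin θ) • EuclideanSpace.single 0 1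
          + (r * Real.cos θ) • EuclideanSpace.single 1 1) θ := by
      simp only [circlePoint_eq]
      exact ((((Real.hasDerivAt_cos θ).const_mul r).smul_const
        (EuclideanSpace.single (0 : Fin 2) (1 : ℝ))).add
        (((Real.hasDerivAt_sin θ).const_mul r).smul_const
        (EuclideanSpace.single (1 : Fin 2) (1 : ℝ))))
    have h2 := ((EuclideanSpace.proj i : EuclideanSpace ℝ (Fin 2) →L[ℝ] ℝ).hasFDerivAt).comp_hasDerivAt θ
      ((hfd _).comp_hasDerivAt θ h1)
    simpa [hD, Function.comp_def] using h2
  have hDc : ∀ i j, Continuous fun p : ℝ × ℝ => D p.1 p.2 i j := by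
    intro i j
    have h1 := hv.continuous_fderiv (by simp)
    have h2 : Continuous fun x => (fderiv ℝ v x (EuclideanSpace.single j 1)) i := by fun_prop
    rw [hD]
    exact h2.comp continuous_circlePoint
  have hvc : ∀ i, Continuous fun p : ℝ × ℝ => v (circlePoint p.1 p.2) i := by
    intro i
    have h1 := hv.continuous
    have h2 : Continuous fun x => v x i := by fun_prop
    exact h2.comp continuous_circlePoint
  -- the polar form of the divergence is `∂_r (r v_r) + ∂_θ v_θ`
  obtain ⟨dr, hdr⟩ : ∃ dr : ℝ × ℝ → ℝ, dr = fun p => (a p.1 p.2 * Real.cos p.2 + b p.1 p.2 * Real.sin p.2)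
    + p.1 * ((Real.cos p.2 * D p.1 p.2 0 0 + Real.sin p.2 * D p.1 p.2 0 1) * Real.cos p.2
      + (Real.cos p.2 * D p.1 p.2 1 0 + Real.sin p.2 * D p.1 p.2 1 1) * Real.sin p.2) := ⟨_, rfl⟩
  obtain ⟨dt, hdt⟩ : ∃ dt : ℝ × ℝ → ℝ, dt = fun p =>
    (-(p.1 * Real.sin p.2) * D p.1 p.2 1 0 + p.1 * Real.cos p.2 * D p.1 p.2 1 1) * Real.cos p.2
      + b p.1 p.2 * (-Real.sin p.2)
      - ((-(p.1 * Real.sin p.2) * D p.1 p.2 0 0 + p.1 * Real.cos p.2 * D p.1 p.2 0 1)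
        * Real.sin p.2 + a p.1 p.2 * Real.cos p.2) := ⟨_, rfl⟩
  have hsum : ∀ p : ℝ × ℝ, p.1 * divergence v (circlePoint p.1 p.2) = dr p + dt p := by
    intro p
    have : divergence v (circlePoint p.1 p.2) = D p.1 p.2 0 0 + D p.1 p.2 1 1 := by
      simp [divergence, hD]
    rw [this]
    simp only [hdr, hdt]
    linear_combination (-(p.1 * (D p.1 p.2 0 0 + D p.1 p.2 1 1))) *
      Real.sin_sq_add_cos_sq p.2
  have hac : Continuous fun p : ℝ × ℝ => a p.1 p.2 := ha ▸ hvc 0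
  have hbc : Continuous fun p : ℝ × ℝ => b p.1 p.2 := hb ▸ hvc 1
  have h00 := hDc 0 0
  have h01 := hDc 0 1
  have h10 := hDc 1 0
  have h11 := hDc 1 1
  have hdrc : Continuous dr := by rw [hdr]; fun_prop
  have hdtc : Continuous dt := by rw [hdt]; fun_prop
  have hpi : -Real.pi ≤ Real.pi := by linarith [Real.pi_pos]
  have hint : ∀ f : ℝ × ℝ → ℝ, Continuous f →
      IntegrableOn f (Ioo 0 ρ ×ˢ Ioo (-Real.pi) Real.pi) (volume.prod volume) := by
    intro f hf
    exact (hf.continuousOn.integrableOn_compact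
      (isCompact_Icc.prod isCompact_Icc : IsCompact (Icc 0 ρ ×ˢ Icc (-Real.pi) Real.pi))).mono_set
      (prod_mono Ioo_subset_Icc_self Ioo_subset_Icc_self)
  have hset : ∀ f : ℝ → ℝ, ∀ s t : ℝ, s ≤ t → ∫ x in Ioo s t, f x = ∫ x in s..t, f x := by
    intro f s t hst
    rw [intervalIntegral.integral_of_le hst, integral_Ioc_eq_integral_Ioo]
  have hpolar : ∫ x in Metric.ball 0 ρ, divergence v x
      = ∫ p in Ioo 0 ρ ×ˢ Ioo (-Real.pi) Real.pi, (dr p + dt p) := by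
    rw [← integral_indicator Metric.isOpen_ball.measurableSet, integral_polar]
    have : Ioo 0 ρ ×ˢ Ioo (-Real.pi) Real.pi
        = (Ioi (0 : ℝ) ×ˢ Ioo (-Real.pi) Real.pi) ∩ {p | p.1 < ρ} := by
      ext p; simp only [mem_prod, mem_Ioo, mem_inter_iff, mem_Ioi, mem_ofPred_eq]; tauto
    rw [this, ← setIntegral_indicator (measurableSet_lt measurable_fst measurable_const)]
    refine setIntegral_congr_fun (measurableSet_Ioi.prod measurableSet_Ioo) fun p hp => ?_
    have hp0 : 0 < p.1 := hp.1
    by_cases h : p.1 < ρ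
    · rw [indicator_of_mem (by simpa [norm_circlePoint, abs_of_pos hp0] using h),
        indicator_of_mem (by simpa using h), hsum]
    · rw [indicator_of_notMem (by simpa [norm_circlePoint, abs_of_pos hp0] using h),
        indicator_of_notMem (by simpa using h), mul_zero]
  have hT : ∫ p in Ioo 0 ρ ×ˢ Ioo (-Real.pi) Real.pi, dt p = 0 := by
    rw [Measure.volume_eq_prod, setIntegral_prod _ (hint _ hdtc)]
    refine integral_eq_zero_of_ae (ae_of_all _ fun r => ?_)
    have hder : ∀ θ, HasDerivAt (fun t => b r t * Real.cos t - a r t * Real.sin t) (dt (r, θ)) θ := by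
      intro θ
      rw [hdt, ha, hb]
      exact ((hct 1 r θ).mul (Real.hasDerivAt_cos θ)).sub
        ((hct 0 r θ).mul (Real.hasDerivAt_sin θ))
    simp only [Pi.zero_apply]
    rw [hset _ _ _ hpi, intervalIntegral.integral_eq_sub_of_hasDerivAt (fun θ _ => hder θ)
      ((hdtc.comp (by fun_prop : Continuous fun θ : ℝ => (r, θ))).intervalIntegrable _ _)]
    simp [ha, hb, circlePoint]
  have hR : ∫ p in Ioo 0 ρ ×ˢ Ioo (-Real.pi) Real.pi, dr p
      = ∫ θ in (-Real.pi)..Real.pi, ρ * (a ρ θ * Real.cos θ + b ρ θ * Real.sin θ) := by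
    rw [Measure.volume_eq_prod, setIntegral_prod _ (hint _ hdrc), ← hset _ _ _ hpi,
      integral_integral_swap (f := fun x y => dr (x, y))]
    · refine setIntegral_congr_fun measurableSet_Ioo fun θ _ => ?_
      have hder : ∀ r, HasDerivAt (fun r => r * (a r θ * Real.cos θ + b r θ * Real.sin θ))
          (dr (r, θ)) r := by
        intro r
        have := (hasDerivAt_id r).mul (((hcr 0 r θ).mul_const (Real.cos θ)).add
          ((hcr 1 r θ).mul_const (Real.sin θ)))
        simp only [id, one_mul] at this
        rw [hdr, ha, hb]
        exact this
      rw [hset _ _ _ hρ.le, intervalIntegral.integral_eq_sub_of_hasDerivAt (fun r _ => hder r)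
        ((hdrc.comp (by fun_prop : Continuous fun r : ℝ => (r, θ))).intervalIntegrable _ _)]
      simp
    · rw [Measure.prod_restrict]
      exact hint _ hdrc
  rw [hpolar, integral_add (by exact hint _ hdrc) (by exact hint _ hdtc), hT, hR, add_zero]
  have hper : Function.Periodic
      (fun θ => ρ * (a ρ θ * Real.cos θ + b ρ θ * Real.sin θ)) (2 * Real.pi) := by
    intro θ; simp [ha, hb, circlePoint]
  have := hper.intervalIntegral_add_eq (-Real.pi) 0
  rw [zero_add, show -Real.pi + 2 * Real.pi = Real.pi by ring] at this
  rw [this]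
  refine intervalIntegral.integral_congr fun θ _ => ?_
  simp only [gradient_radius, norm_circlePoint, abs_of_pos hρ]
  simp only [ha, hb, circlePoint, PiLp.inner_apply, Fin.sum_univ_two, PiLp.smul_apply]
  congr 1
  simp
  field_simp

section

/-! ### Convergence in `L^q` -/

/-- Bounded pointwise convergence on a finite measure space implies convergence in `L^q`,
`q < ∞`. -/
theorem tendsto_eLpNorm_sub_of_bounded {α E : Type*} [MeasurableSpace α] [NormedAddCommGroup E]
    {μ : Measure α} [IsFiniteMeasure μ] {q : ℝ≥0∞} (hq : 1 ≤ q) (hq' : q ≠ ⊤)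
    {F : ℕ → α → E} {f : α → E} {M : ℝ} (hF : ∀ n, AEStronglyMeasurable (F n) μ)
    (hM : ∀ n, ∀ᵐ x ∂μ, ‖F n x‖ ≤ M) (hlim : ∀ᵐ x ∂μ, Tendsto (fun n => F n x) atTop (𝓝 (f x))) :
    MemLp f q μ ∧ Tendsto (fun n => eLpNorm (fun x => F n x - f x) q μ) atTop (𝓝 0) := by
  have hf : MemLp f q μ := by
    refine MemLp.of_bound (aestronglyMeasurable_of_tendsto_ae atTop hF hlim) M ?_
    filter_upwards [hlim, ae_all_iff.2 hM] with x hx hMx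
    exact le_of_tendsto hx.norm (Eventually.of_forall hMx)
  refine ⟨hf, tendsto_Lp_finite_of_tendsto_ae hq hq' hF hf (unifIntegrable_of hq hq' hF ?_) hlim⟩
  refine fun ε _ => ⟨(|M| + 1).toNNReal, fun n => ?_⟩
  have : {x | (|M| + 1).toNNReal ≤ ‖F n x‖₊}.indicator (F n) =ᵐ[μ] 0 := by
    filter_upwards [hM n] with x hx
    refine indicator_of_notMem (fun hx' => ?_) _
    have h1 : |M| + 1 ≤ ‖F n x‖ := by
      rw [mem_ofPred_eq, Real.toNNReal_le_iff_le_coe] at hx'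
      simpa using hx'
    linarith [le_abs_self M]
  rw [eLpNorm_congr_ae this]
  simp

theorem tendsto_integral_inner {α E : Type*} [MeasurableSpace α] [NormedAddCommGroup E]
    [InnerProductSpace ℝ E] {μ : Measure α} {F G : ℕ → α → E} {f g : α → E}
    (hF : ∀ n, MemLp (F n) 2 μ) (hf : MemLp f 2 μ) (hG : ∀ n, MemLp (G n) 2 μ) (hg : MemLp g 2 μ)
    (hFf : Tendsto (fun n => eLpNorm (fun x => F n x - f x) 2 μ) atTop (𝓝 0))
    (hGg : Tendsto (fun n => eLpNorm (fun x => G n x - g x) 2 μ) atTop (𝓝 0)) :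
    Tendsto (fun n => ∫ x, inner ℝ (F n x) (G n x) ∂μ) atTop (𝓝 (∫ x, inner ℝ (f x) (g x) ∂μ)) := by
  have key : ∀ {a b : α → E} (ha : MemLp a 2 μ) (hb : MemLp b 2 μ),
      ∫ x, inner ℝ (a x) (b x) ∂μ = inner ℝ (ha.toLp a) (hb.toLp b) := by
    intro a b ha hb
    rw [L2.inner_def]
    refine integral_congr_ae ?_
    filter_upwards [ha.coeFn_toLp, hb.coeFn_toLp] with x h1 h2
    rw [h1, h2]
  have h1 := (Lp.tendsto_Lp_iff_tendsto_eLpNorm'' F hF f hf).2 hFf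
  have h2 := (Lp.tendsto_Lp_iff_tendsto_eLpNorm'' G hG g hg).2 hGg
  rw [key hf hg]
  exact (h1.inner h2).congr fun n => (key (hF n) (hG n)).symm

theorem integrable_inner_of_memLp {α E : Type*} [MeasurableSpace α] [NormedAddCommGroup E]
    [InnerProductSpace ℝ E] {μ : Measure α} {f g : α → E} (hf : MemLp f 2 μ) (hg : MemLp g 2 μ) :
    Integrable (fun x => inner ℝ (f x) (g x)) μ := by
  refine (L2.integrable_inner (𝕜 := ℝ) (hf.toLp f) (hg.toLp g)).congr ?_
  filter_upwards [hf.coeFn_toLp, hg.coeFn_toLp] with x h1 h2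
  rw [h1, h2]

/-! ### Test functions and `H¹₀` -/

variable {N : ℕ} {Ω : Set (EuclideanSpace ℝ (Fin N))}

theorem continuous_gradient {φ : EuclideanSpace ℝ (Fin N) → ℝ} (hφ : ContDiff ℝ 1 φ) :
    Continuous (gradient φ) :=
  (InnerProductSpace.toDual ℝ (EuclideanSpace ℝ (Fin N))).symm.continuous.comp
    (hφ.continuous_fderiv (by simp))

theorem gradient_eq_zero_of_notMem_tsupport {φ : EuclideanSpace ℝ (Fin N) → ℝ}
    {x : EuclideanSpace ℝ (Fin N)} (hx : x ∉ tsupport φ) : gradient φ x = 0 := by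
  have : fderiv ℝ φ x = 0 := by
    by_contra h
    exact hx (support_fderiv_subset ℝ h)
  simp [gradient, this]

theorem IsTest.memLp {F : Type*} [NormedAddCommGroup F] [NormedSpace ℝ F] {k : WithTop ℕ∞}
    {φ : EuclideanSpace ℝ (Fin N) → F} (hφ : IsTest k Ω φ) (q : ℝ≥0∞)
    (μ : Measure (EuclideanSpace ℝ (Fin N))) [IsFiniteMeasureOnCompacts μ] : MemLp φ q μ :=
  hφ.contDiff.continuous.memLp_of_hasCompactSupport hφ.hasCompactSupport

theorem IsTest.mono_order {F : Type*} [NormedAddCommGroup F] [NormedSpace ℝ F] {k l : WithTop ℕ∞}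
    {φ : EuclideanSpace ℝ (Fin N) → F} (hφ : IsTest k Ω φ) (h : l ≤ k) : IsTest l Ω φ :=
  ⟨hφ.contDiff.of_le h, hφ.hasCompactSupport, hφ.tsupport_subset⟩

theorem IsTest.memLp_gradient {φ : EuclideanSpace ℝ (Fin N) → ℝ} (hφ : IsTest 1 Ω φ) (q : ℝ≥0∞)
    (μ : Measure (EuclideanSpace ℝ (Fin N))) [IsFiniteMeasureOnCompacts μ] :
    MemLp (gradient φ) q μ :=
  (continuous_gradient hφ.contDiff).memLp_of_hasCompactSupport
    (hφ.hasCompactSupport.mono' fun x hx => by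
      by_contra h
      exact hx (gradient_eq_zero_of_notMem_tsupport h))

theorem IsTest.gradient {φ : EuclideanSpace ℝ (Fin N) → ℝ} (hφ : IsTest ∞ Ω φ) :
    IsTest ∞ Ω (gradient φ) := by
  have hs : tsupport (_root_.gradient φ) ⊆ tsupport φ :=
    closure_minimal (fun x hx => by
      by_contra h
      exact hx (gradient_eq_zero_of_notMem_tsupport h)) (isClosed_tsupport φ)
  exact ⟨(InnerProductSpace.toDual ℝ (EuclideanSpace ℝ (Fin N))).symm.toContinuousLinearEquiv
    |>.contDiff.comp (hφ.contDiff.fderiv_right (m := ∞) (by simp)),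
    hφ.hasCompactSupport.mono' (subset_closure.trans hs), hs.trans hφ.tsupport_subset⟩

theorem IsTest.sub {F : Type*} [NormedAddCommGroup F] [NormedSpace ℝ F] {k : WithTop ℕ∞}
    {φ ψ : EuclideanSpace ℝ (Fin N) → F} (hφ : IsTest k Ω φ) (hψ : IsTest k Ω ψ) :
    IsTest k Ω (fun x => φ x - ψ x) :=
  ⟨hφ.contDiff.sub hψ.contDiff, hφ.hasCompactSupport.sub hψ.hasCompactSupport,
    (tsupport_sub φ ψ).trans (union_subset hφ.tsupport_subset hψ.tsupport_subset)⟩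

/-- The product of a test function and a field that is merely `C¹` in `Ω` is a `C¹` test field. -/
theorem IsTest.smul_contDiffOn {φ : EuclideanSpace ℝ (Fin N) → ℝ} (hφ : IsTest ∞ Ω φ)
    {G : EuclideanSpace ℝ (Fin N) → EuclideanSpace ℝ (Fin N)}
    (hG : ∀ x ∈ Ω, ContDiffAt ℝ 1 G x) : IsTest 1 Ω (fun x => φ x • G x) := by
  have hs : tsupport (fun x => φ x • G x) ⊆ tsupport φ := tsupport_smul_subset_left φ G
  refine ⟨contDiff_iff_contDiffAt.2 fun x => ?_, hφ.hasCompactSupport.smul_right,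
    hs.trans hφ.tsupport_subset⟩
  by_cases hx : x ∈ tsupport fun x => φ x • G x
  swap
  · exact contDiffAt_const.congr_of_eventuallyEq (notMem_tsupport_iff_eventuallyEq.1 hx)
  exact (hφ.contDiff.of_le (by simp)).contDiffAt.smul (hG x (hφ.tsupport_subset (hs hx)))

theorem integral_inner_gradient_test (hΩ : IsOpen Ω) {φ : EuclideanSpace ℝ (Fin N) → ℝ}
    (hφ : IsTest ∞ Ω φ) {G : EuclideanSpace ℝ (Fin N) → EuclideanSpace ℝ (Fin N)}
    (hG : ∀ x ∈ Ω, ContDiffAt ℝ 1 G x) (hG2 : MemLp G 2 (volume.restrict Ω))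
    (hd2 : MemLp (divergence G) 2 (volume.restrict Ω)) :
    ∫ x in Ω, inner ℝ (gradient φ x) (G x) = -∫ x in Ω, φ x * divergence G x := by
  have ht := hφ.smul_contDiffOn hG
  have h0 := integral_divergence_eq_zero ht.contDiff ht.hasCompactSupport
  have h1 : ∫ x in Ω, divergence (fun x => φ x • G x) x = 0 := by
    rw [setIntegral_eq_integral_of_forall_compl_eq_zero, h0]
    exact fun x hx => divergence_eq_zero_of_notMem_tsupport fun h => hx (ht.tsupport_subset h)
  have h2 : ∫ x in Ω, divergence (fun x => φ x • G x) x
      = ∫ x in Ω, (φ x * divergence G x + inner ℝ (gradient φ x) (G x)) :=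
    setIntegral_congr_fun hΩ.measurableSet fun x hx =>
      divergence_smul (hφ.contDiff.differentiable (by simp) x)
        ((hG x hx).differentiableAt (by simp))
  have hi : Integrable (fun x => φ x * divergence G x) (volume.restrict Ω) :=
    (hφ.memLp 2 _).integrable_mul hd2
  have hi2 := integrable_inner_of_memLp ((hφ.mono_order (l := 1) (by simp)).memLp_gradient 2
    (volume.restrict Ω)) hG2
  rw [h2, integral_add hi hi2] at h1
  linarith

/-- Integration by parts against elements of `H¹₀(Ω)`. -/
theorem IsH10.integral_inner_eq (hΩ : IsOpen Ω) {y : EuclideanSpace ℝ (Fin N) → ℝ}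
    {g G : EuclideanSpace ℝ (Fin N) → EuclideanSpace ℝ (Fin N)} (hy : IsH10 Ω y g)
    (hG : ∀ x ∈ Ω, ContDiffAt ℝ 1 G x) (hG2 : MemLp G 2 (volume.restrict Ω))
    (hd2 : MemLp (divergence G) 2 (volume.restrict Ω)) :
    ∫ x in Ω, inner ℝ (g x) (G x) = -∫ x in Ω, y x * divergence G x := by
  obtain ⟨φ, hφ, hφy, hφg⟩ := hy.approx
  have h1 := tendsto_integral_inner (fun n => ((hφ n).mono_order (l := 1) (by simp)).memLp_gradient 2
    (volume.restrict Ω)) hy.memLp_grad (fun _ => hG2) hG2 hφg (by simp)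
  have h2 := tendsto_integral_inner (fun n => (hφ n).memLp 2 (volume.restrict Ω)) hy.memLp
    (fun _ => hd2) hd2 hφy (by simp)
  simp only [RCLike.inner_apply, conj_trivial, mul_comm (divergence G _)] at h2
  exact tendsto_nhds_unique h1 (h2.neg.congr fun n =>
    (integral_inner_gradient_test hΩ (hφ n) hG hG2 hd2).symm)

theorem IsH10.sub {y y' : EuclideanSpace ℝ (Fin N) → ℝ}
    {g g' : EuclideanSpace ℝ (Fin N) → EuclideanSpace ℝ (Fin N)} (hy : IsH10 Ω y g)
    (hy' : IsH10 Ω y' g') : IsH10 Ω (fun x => y x - y' x) (fun x => g x - g' x) := by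
  obtain ⟨φ, hφ, h1, h2⟩ := hy.approx
  obtain ⟨ψ, hψ, h3, h4⟩ := hy'.approx
  refine ⟨hy.memLp.sub hy'.memLp, hy.memLp_grad.sub hy'.memLp_grad, fun n x => φ n x - ψ n x,
    fun n => (hφ n).sub (hψ n), ?_, ?_⟩
  · refine tendsto_of_tendsto_of_tendsto_of_le_of_le tendsto_const_nhds
      (by simpa using h1.add h3) (fun _ => zero_le) fun n => ?_
    refine le_trans (le_of_eq ?_) (eLpNorm_sub_le
      (((hφ n).memLp 2 _).aestronglyMeasurable.sub hy.memLp.aestronglyMeasurable)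
      (((hψ n).memLp 2 _).aestronglyMeasurable.sub hy'.memLp.aestronglyMeasurable) (by norm_num))
    congr 1
    funext x
    simp only [Pi.sub_apply]
    abel
  · have hd : ∀ n x, gradient (fun x => φ n x - ψ n x) x = gradient (φ n) x - gradient (ψ n) x := by
      intro n x
      simp only [gradient]
      rw [fderiv_fun_sub ((hφ n).contDiff.differentiable (by simp) x)
        ((hψ n).contDiff.differentiable (by simp) x), map_sub]
    refine tendsto_of_tendsto_of_tendsto_of_le_of_le tendsto_const_nhds
      (by simpa using h2.add h4) (fun _ => zero_le) fun n => ?_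
    refine le_trans (le_of_eq ?_) (eLpNorm_sub_le
      ((((hφ n).mono_order (l := 1) (by simp)).memLp_gradient 2 _).aestronglyMeasurable.sub
        hy.memLp_grad.aestronglyMeasurable)
      ((((hψ n).mono_order (l := 1) (by simp)).memLp_gradient 2 _).aestronglyMeasurable.sub
        hy'.memLp_grad.aestronglyMeasurable) (by norm_num))
    congr 1
    funext x
    simp only [Pi.sub_apply, hd]
    abel

/-- **Poincaré inequality** for test functions, from `div (φ² x) = N φ² + 2 φ ∇φ · x`. -/
theorem integral_sq_le_of_isTest (hN : 0 < N) (hΩ : IsOpen Ω) {ρ : ℝ}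
    (hb : Ω ⊆ Metric.ball 0 ρ) {φ : EuclideanSpace ℝ (Fin N) → ℝ} (hφ : IsTest ∞ Ω φ) :
    ∫ x in Ω, φ x * φ x ≤ 4 * ρ ^ 2 * ∫ x in Ω, inner ℝ (gradient φ x) (gradient φ x) := by
  have hN1 : (1 : ℝ) ≤ N := by exact_mod_cast hN
  have hφd : ∀ x, DifferentiableAt ℝ φ x := fun x => hφ.contDiff.differentiable (by simp) x
  have ht : IsTest 1 Ω (fun x => φ x • (φ x • x)) :=
    hφ.smul_contDiffOn fun x _ =>
      ((hφ.contDiff.of_le (by simp) : ContDiff ℝ 1 φ).smul contDiff_id).contDiffAt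
  have h0 := integral_divergence_eq_zero ht.contDiff ht.hasCompactSupport
  have hφ2 := hφ.memLp 2 (volume.restrict Ω)
  have hg2 := (hφ.mono_order (l := 1) (by simp)).memLp_gradient 2 (volume.restrict Ω)
  have hx2 : MemLp (fun x => φ x • x) 2 (volume.restrict Ω) :=
    (hφ.contDiff.continuous.smul continuous_id).memLp_of_hasCompactSupport
      hφ.hasCompactSupport.smul_right
  have h1 : ∫ x in Ω, (N * (φ x * φ x) + 2 * inner ℝ (gradient φ x) (φ x • x)) = 0 := by
    rw [← h0, ← setIntegral_eq_integral_of_forall_compl_eq_zero (s := Ω)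
      (f := divergence fun x => φ x • φ x • x)]
    · refine setIntegral_congr_fun hΩ.measurableSet fun x _ => ?_
      rw [divergence_smul (G := fun x => φ x • x) (hφd x)
        ((hφd x).smul differentiableAt_fun_id : DifferentiableAt ℝ (fun x => φ x • x) x),
        divergence_smul (hφd x) differentiableAt_fun_id, divergence_id, inner_smul_right]
      ring
    · exact fun x hx => divergence_eq_zero_of_notMem_tsupport fun h => hx (ht.tsupport_subset h)
  have i1 : Integrable (fun x => φ x * φ x) (volume.restrict Ω) := hφ2.integrable_mul hφ2
  have i2 := integrable_inner_of_memLp hg2 hx2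
  have i3 := integrable_inner_of_memLp hg2 hg2
  rw [integral_add (i1.const_mul _) (i2.const_mul _), integral_const_mul, integral_const_mul] at h1
  have h2 : -∫ x in Ω, inner ℝ (gradient φ x) (φ x • x) ≤
      ∫ x in Ω, (1 / 4 * (φ x * φ x) + ρ ^ 2 * inner ℝ (gradient φ x) (gradient φ x)) := by
    rw [← integral_neg]
    refine setIntegral_mono_on i2.neg ((i1.const_mul _).add (i3.const_mul _)) hΩ.measurableSet
      fun x hx => ?_
    have hxρ : ‖x‖ ≤ ρ := (mem_ball_zero_iff.1 (hb hx)).le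
    have hc := abs_real_inner_le_norm (gradient φ x) (φ x • x)
    rw [norm_smul, Real.norm_eq_abs] at hc
    rw [real_inner_self_eq_norm_sq]
    have h3 : ‖gradient φ x‖ * (|φ x| * ‖x‖) ≤ ‖gradient φ x‖ * (|φ x| * ρ) := by gcongr
    have h4 := sq_nonneg (1 / 2 * |φ x| - ρ * ‖gradient φ x‖)
    have h5 := sq_abs (φ x)
    have h6 := neg_abs_le (inner ℝ (gradient φ x) (φ x • x))
    nlinarith
  rw [integral_add (i1.const_mul _) (i3.const_mul _), integral_const_mul, integral_const_mul] at h2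
  have h3 : 0 ≤ ∫ x in Ω, φ x * φ x := integral_nonneg fun x => mul_self_nonneg _
  nlinarith

/-- Elements of `H¹₀(Ω)` that are orthogonal to all test functions vanish. -/
theorem IsH10.ae_eq_zero (hN : 0 < N) (hΩ : IsOpen Ω) {ρ : ℝ} (hb : Ω ⊆ Metric.ball 0 ρ)
    {w : EuclideanSpace ℝ (Fin N) → ℝ} {g : EuclideanSpace ℝ (Fin N) → EuclideanSpace ℝ (Fin N)}
    (hw : IsH10 Ω w g)
    (h : ∀ φ : EuclideanSpace ℝ (Fin N) → ℝ, IsTest ∞ Ω φ →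
      ∫ x in Ω, inner ℝ (g x) (gradient φ x) = 0) :
    w =ᵐ[volume.restrict Ω] 0 := by
  obtain ⟨φ, hφ, hφw, hφg⟩ := hw.approx
  have hg2 := fun n => ((hφ n).mono_order (l := 1) (by simp)).memLp_gradient 2 (volume.restrict Ω)
  have h1 := tendsto_integral_inner (fun _ => hw.memLp_grad) hw.memLp_grad hg2 hw.memLp_grad
    (by simp) hφg
  have h2 := tendsto_integral_inner hg2 hw.memLp_grad hg2 hw.memLp_grad hφg hφg
  have h3 := tendsto_integral_inner (fun n => (hφ n).memLp 2 (volume.restrict Ω)) hw.memLp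
    (fun n => (hφ n).memLp 2 (volume.restrict Ω)) hw.memLp hφw hφw
  simp only [h _ (hφ _)] at h1
  rw [tendsto_nhds_unique h1 tendsto_const_nhds] at h2
  simp only [RCLike.inner_apply, conj_trivial] at h3
  have h4 := le_of_tendsto_of_tendsto' h3 (h2.const_mul (4 * ρ ^ 2)) fun n =>
    integral_sq_le_of_isTest hN hΩ hb (hφ n)
  have i1 : Integrable (fun x => w x * w x) (volume.restrict Ω) := hw.memLp.integrable_mul hw.memLp
  have h5 : ∫ x in Ω, w x * w x = 0 :=
    le_antisymm (by simpa using h4) (integral_nonneg fun x => mul_self_nonneg _)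
  rw [integral_eq_zero_iff_of_nonneg (fun x => mul_self_nonneg _) i1] at h5
  filter_upwards [h5] with x hx
  simpa using hx

/-- Uniqueness of weak solutions with homogeneous Dirichlet conditions. -/
theorem IsWeakSolution.ae_eq (hN : 0 < N) (hΩ : IsOpen Ω) {ρ : ℝ} (hb : Ω ⊆ Metric.ball 0 ρ)
    {u y y' : EuclideanSpace ℝ (Fin N) → ℝ} (hy : IsWeakSolution Ω u y)
    (hy' : IsWeakSolution Ω u y') : y =ᵐ[volume.restrict Ω] y' := by
  obtain ⟨-, g, hg, h⟩ := hy
  obtain ⟨-, g', hg', h'⟩ := hy'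
  have := (hg.sub hg').ae_eq_zero hN hΩ hb fun φ hφ => by
    have h2 := (hφ.mono_order (l := 1) (by simp)).memLp_gradient 2 (volume.restrict Ω)
    simp only [inner_sub_left]
    rw [integral_sub (integrable_inner_of_memLp hg.memLp_grad h2)
      (integrable_inner_of_memLp hg'.memLp_grad h2), h φ hφ, h' φ hφ, sub_self]
  filter_upwards [this] with x hx
  exact sub_eq_zero.1 hx

theorem integrable_mul_isTest {u φ : EuclideanSpace ℝ (Fin N) → ℝ} (hu : IntegrableOn u Ω)
    {k : WithTop ℕ∞} (hφ : IsTest k Ω φ) :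
    Integrable (fun x => u x * φ x) (volume.restrict Ω) := by
  obtain ⟨C, hC⟩ := hφ.contDiff.continuous.bounded_above_of_compact_support hφ.hasCompactSupport
  exact Integrable.mul_bdd (c := C) hu hφ.contDiff.continuous.aestronglyMeasurable (ae_of_all _ hC)

/-- The right-hand side is determined by the weak solution: after a second integration by parts,
only `∫ y Δφ` is left on the side of the solution. -/
theorem IsWeakSolution.rhs_ae_eq (hΩ : IsOpen Ω) {u u' y y' : EuclideanSpace ℝ (Fin N) → ℝ}
    (hy : IsWeakSolution Ω u y) (hy' : IsWeakSolution Ω u' y')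
    (h : y =ᵐ[volume.restrict Ω] y') : u =ᵐ[volume.restrict Ω] u' := by
  obtain ⟨hu, g, hg, hw⟩ := hy
  obtain ⟨hu', g', hg', hw'⟩ := hy'
  have key : ∀ φ : EuclideanSpace ℝ (Fin N) → ℝ, IsTest ∞ Ω φ →
      ∫ x in Ω, u x * φ x = ∫ x in Ω, u' x * φ x := by
    intro φ hφ
    have ht := hφ.gradient
    have hG : ∀ x ∈ Ω, ContDiffAt ℝ 1 (gradient φ) x := fun x _ =>
      (ht.contDiff.of_le (by simp)).contDiffAt
    have hd2 : MemLp (divergence (gradient φ)) 2 (volume.restrict Ω) :=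
      (continuous_divergence (ht.contDiff.of_le (by simp))).memLp_of_hasCompactSupport
        (ht.hasCompactSupport.mono' fun x hx => by
          by_contra h
          exact hx (divergence_eq_zero_of_notMem_tsupport h))
    rw [← hw φ hφ, ← hw' φ hφ, hg.integral_inner_eq hΩ hG (ht.memLp 2 _) hd2,
      hg'.integral_inner_eq hΩ hG (ht.memLp 2 _) hd2]
    congr 1
    refine integral_congr_ae ?_
    filter_upwards [h] with x hx
    rw [hx]
  have := hΩ.ae_eq_zero_of_integral_contDiff_smul_eq_zero (μ := volume) (f := fun x => u x - u' x)
    (hu.sub hu').locallyIntegrableOn fun φ h1 h2 h3 => by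
      have hφ : IsTest ∞ Ω φ := ⟨h1, h2, h3⟩
      rw [← setIntegral_eq_integral_of_forall_compl_eq_zero (s := Ω) fun x hx => by
        rw [image_eq_zero_of_notMem_tsupport fun h => hx (h3 h), zero_smul]]
      have := key φ hφ
      rw [← sub_eq_zero, ← integral_sub (integrable_mul_isTest hu hφ)
        (integrable_mul_isTest hu' hφ)] at this
      rw [← this]
      congr 1
      funext x
      simp only [smul_eq_mul]
      ring
  rw [EventuallyEq, ae_restrict_iff' hΩ.measurableSet]
  filter_upwards [this] with x hx hxΩ
  exact sub_eq_zero.1 (hx hxΩ)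

end

section

/-! ### Sufficiency of the first-order conditions -/

/-- Bounded pointwise convergence `Fₙ → f` on the set `Ω`. -/
structure BddTendsto {α E : Type*} [NormedAddCommGroup E] (Ω : Set α) (F : ℕ → α → E)
    (f : α → E) : Prop where
  bdd : ∃ M : ℝ, ∀ n, ∀ x ∈ Ω, ‖F n x‖ ≤ M
  tendsto : ∀ x ∈ Ω, Tendsto (fun n => F n x) atTop (𝓝 (f x))

variable {N : ℕ} {Ω : Set (EuclideanSpace ℝ (Fin N))}

theorem BddTendsto.eLpNorm {E : Type*} [NormedAddCommGroup E] (hΩ : MeasurableSet Ω)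
    (hfin : volume Ω ≠ ⊤) {F : ℕ → EuclideanSpace ℝ (Fin N) → E} {f : EuclideanSpace ℝ (Fin N) → E}
    (h : BddTendsto Ω F f) (hF : ∀ n, Continuous (F n)) {q : ℝ≥0∞} (hq : 1 ≤ q) (hq' : q ≠ ⊤) :
    MemLp f q (volume.restrict Ω) ∧
      Tendsto (fun n => eLpNorm (fun x => F n x - f x) q (volume.restrict Ω)) atTop (𝓝 0) := by
  have : IsFiniteMeasure (volume.restrict Ω) := ⟨by simpa using hfin.lt_top⟩
  obtain ⟨M, hM⟩ := h.bdd
  exact tendsto_eLpNorm_sub_of_bounded hq hq' (fun n => (hF n).aestronglyMeasurable)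
    (fun n => ae_restrict_of_forall_mem hΩ (hM n)) (ae_restrict_of_forall_mem hΩ h.tendsto)

theorem BddTendsto.integral_mul (hΩ : MeasurableSet Ω) {u : EuclideanSpace ℝ (Fin N) → ℝ}
    (hu : IntegrableOn u Ω) {F : ℕ → EuclideanSpace ℝ (Fin N) → ℝ}
    {f : EuclideanSpace ℝ (Fin N) → ℝ} (h : BddTendsto Ω F f) (hF : ∀ n, Continuous (F n)) :
    Integrable (fun x => u x * f x) (volume.restrict Ω) ∧
    Tendsto (fun n => ∫ x in Ω, u x * F n x) atTop (𝓝 (∫ x in Ω, u x * f x)) := by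
  obtain ⟨M, hM⟩ := h.bdd
  have hm : AEStronglyMeasurable f (volume.restrict Ω) :=
    aestronglyMeasurable_of_tendsto_ae atTop (fun n => (hF n).aestronglyMeasurable)
      (ae_restrict_of_forall_mem hΩ h.tendsto)
  constructor
  · refine Integrable.mul_bdd (c := M) hu hm (ae_restrict_of_forall_mem hΩ fun x hx => ?_)
    exact le_of_tendsto (h.tendsto x hx).norm (Eventually.of_forall fun n => hM n x hx)
  · refine tendsto_integral_of_dominated_convergence (fun x => ‖u x‖ * M)
      (fun n => hu.aestronglyMeasurable.mul (hF n).aestronglyMeasurable) (hu.norm.mul_const M)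
      (fun n => ae_restrict_of_forall_mem hΩ fun x hx => ?_)
      (ae_restrict_of_forall_mem hΩ fun x hx => (h.tendsto x hx).const_mul _)
    rw [norm_mul]
    exact mul_le_mul_of_nonneg_left (hM n x hx) (norm_nonneg _)

theorem IsH10.of_bddTendsto (hΩ : MeasurableSet Ω) (hfin : volume Ω ≠ ⊤)
    {φ : ℕ → EuclideanSpace ℝ (Fin N) → ℝ} (hφ : ∀ n, IsTest ∞ Ω (φ n))
    {y : EuclideanSpace ℝ (Fin N) → ℝ} {g : EuclideanSpace ℝ (Fin N) → EuclideanSpace ℝ (Fin N)}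
    (hy : BddTendsto Ω φ y) (hg : BddTendsto Ω (fun n => gradient (φ n)) g) : IsH10 Ω y g := by
  have h1 := hy.eLpNorm hΩ hfin (fun n => (hφ n).contDiff.continuous) one_le_two (by simp)
  have h2 := hg.eLpNorm hΩ hfin (fun n => continuous_gradient ((hφ n).contDiff.of_le (by simp)))
    one_le_two (by simp)
  exact ⟨h1.1, h2.1, φ, hφ, h1.2, h2.2⟩

theorem ofReal_integral_le_tvSeminorm (u : EuclideanSpace ℝ (Fin N) → ℝ)
    {v : EuclideanSpace ℝ (Fin N) → EuclideanSpace ℝ (Fin N)} (hv : IsTest 1 Ω v)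
    (h : ∀ x, ‖v x‖ ≤ 1) :
    ENNReal.ofReal (∫ x in Ω, u x * divergence v x) ≤ tvSeminorm Ω u :=
  le_iSup₂_of_le v ⟨hv, h⟩ le_rfl

theorem divergence_const_smul (c : ℝ) {v : EuclideanSpace ℝ (Fin N) → EuclideanSpace ℝ (Fin N)}
    {x : EuclideanSpace ℝ (Fin N)} (hv : DifferentiableAt ℝ v x) :
    divergence (fun x => c • v x) x = c * divergence v x := by
  unfold divergence
  rw [fderiv_fun_const_smul hv]
  simp [Finset.mul_sum]

theorem IsTest.const_smul {F : Type*} [NormedAddCommGroup F] [NormedSpace ℝ F] {k : WithTop ℕ∞}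
    {v : EuclideanSpace ℝ (Fin N) → F} (hv : IsTest k Ω v) (c : ℝ) :
    IsTest k Ω (fun x => c • v x) :=
  ⟨contDiff_const.smul hv.contDiff, hv.hasCompactSupport.smul_left (f := fun _ => c),
    (tsupport_smul_subset_right (fun _ => c) v).trans hv.tsupport_subset⟩

/-- The definition of the total variation, applied to `-v / β`. -/
theorem integral_mul_divergence_le {u : EuclideanSpace ℝ (Fin N) → ℝ} (hu : MemBV Ω u) {β : ℝ}
    (hβ : 0 < β) {v : EuclideanSpace ℝ (Fin N) → EuclideanSpace ℝ (Fin N)} (hv : IsTest 1 Ω v)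
    (hvβ : ∀ x, ‖v x‖ ≤ β) :
    -(β * (tvSeminorm Ω u).toReal) ≤ ∫ x in Ω, u x * divergence v x := by
  have hn : ∀ x, ‖(-β⁻¹) • v x‖ ≤ 1 := by
    intro x
    rw [norm_smul, norm_neg, norm_inv, Real.norm_of_nonneg hβ.le, inv_mul_le_iff₀ hβ]
    simpa using hvβ x
  have h1 := ofReal_integral_le_tvSeminorm u (hv.const_smul (-β⁻¹)) hn
  have h3 : ∫ x in Ω, u x * divergence (fun x => (-β⁻¹) • v x) x
      = (-β⁻¹) * ∫ x in Ω, u x * divergence v x := by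
    rw [← integral_const_mul]
    congr 1
    funext x
    rw [divergence_const_smul _ (hv.contDiff.differentiable (by simp) x)]; ring
  rw [h3, ENNReal.ofReal_le_iff_le_toReal hu.2.ne] at h1
  have h4 := mul_le_mul_of_nonneg_left h1 hβ.le
  rw [neg_mul, mul_neg, mul_inv_cancel_left₀ hβ.ne'] at h4
  linarith

/-- First-order conditions are sufficient, with a quadratic growth of the objective. Here `p` is
the adjoint state, `G` its gradient, and `vₙ` approximates a field with divergence `p` that is
dual to `ū`. -/
theorem objective_add_le (hΩ : IsOpen Ω) (hfin : volume Ω ≠ ⊤)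
    {yΩ y₀ u₀ p : EuclideanSpace ℝ (Fin N) → ℝ}
    {G : EuclideanSpace ℝ (Fin N) → EuclideanSpace ℝ (Fin N)} {β : ℝ} (hβ : 0 < β)
    (h₀ : Admissible Ω y₀ u₀) (hyΩ : MemLp yΩ 2 (volume.restrict Ω))
    {φ : ℕ → EuclideanSpace ℝ (Fin N) → ℝ} (hφ : ∀ n, IsTest ∞ Ω (φ n)) (hφp : BddTendsto Ω φ p)
    (hφG : BddTendsto Ω (fun n => gradient (φ n)) G) (hG : ∀ x ∈ Ω, ContDiffAt ℝ 1 G x)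
    (hdG : ∀ x ∈ Ω, divergence G x = yΩ x - y₀ x)
    {v : ℕ → EuclideanSpace ℝ (Fin N) → EuclideanSpace ℝ (Fin N)} (hv : ∀ n, IsTest 1 Ω (v n))
    (hvβ : ∀ n x, ‖v n x‖ ≤ β) (hvp : BddTendsto Ω (fun n => divergence (v n)) p)
    (htv : ∫ x in Ω, u₀ x * p x = -(β * (tvSeminorm Ω u₀).toReal))
    {y u : EuclideanSpace ℝ (Fin N) → ℝ} (h : Admissible Ω y u) :
    objective Ω yΩ β y₀ u₀ + 1 / 2 * ∫ x in Ω, (y x - y₀ x) ^ 2 ≤ objective Ω yΩ β y u := by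
  obtain ⟨hu, -, g, hg, hgw⟩ := h
  obtain ⟨hu₀, -, g₀, hg₀, hgw₀⟩ := h₀
  have hΩm := hΩ.measurableSet
  have hpH := IsH10.of_bddTendsto hΩm hfin hφ hφp hφG
  have hd2 : MemLp (divergence G) 2 (volume.restrict Ω) :=
    (memLp_congr_ae (ae_restrict_of_forall_mem hΩm hdG)).2 (hyΩ.sub hg₀.memLp)
  have hw := hg.sub hg₀
  have iu := hφp.integral_mul hΩm hu.1 fun n => (hφ n).contDiff.continuous
  have iu₀ := hφp.integral_mul hΩm hu₀.1 fun n => (hφ n).contDiff.continuous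
  have hφ2 := fun n => ((hφ n).mono_order (l := 1) (by simp)).memLp_gradient 2 (volume.restrict Ω)
  -- `(y - y₀, -Δ p) = (u - u₀, p)`
  have key : ∫ x in Ω, (y x - y₀ x) * (y₀ x - yΩ x)
      = (∫ x in Ω, u x * p x) - ∫ x in Ω, u₀ x * p x := by
    have h1 := hw.integral_inner_eq hΩ hG hpH.memLp_grad hd2
    have h2 := tendsto_integral_inner (fun _ => hw.memLp_grad) hw.memLp_grad hφ2 hpH.memLp_grad
      (by simp) (hφG.eLpNorm hΩm hfin
        (fun n => continuous_gradient ((hφ n).contDiff.of_le (by simp))) one_le_two (by simp)).2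
    have h3 : ∀ n, ∫ x in Ω, inner ℝ (g x - g₀ x) (gradient (φ n) x)
        = (∫ x in Ω, u x * φ n x) - ∫ x in Ω, u₀ x * φ n x := by
      intro n
      simp only [inner_sub_left]
      rw [integral_sub (integrable_inner_of_memLp hg.memLp_grad (hφ2 n))
        (integrable_inner_of_memLp hg₀.memLp_grad (hφ2 n)), hgw _ (hφ n), hgw₀ _ (hφ n)]
    rw [← tendsto_nhds_unique h2 ((iu.2.sub iu₀.2).congr fun n => (h3 n).symm), h1,
      ← integral_neg]
    refine setIntegral_congr_fun hΩm fun x hx => ?_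
    simp only [hdG x hx]
    ring
  have hup : -(β * (tvSeminorm Ω u).toReal) ≤ ∫ x in Ω, u x * p x :=
    ge_of_tendsto' (hvp.integral_mul hΩm hu.1 fun n => continuous_divergence (hv n).contDiff).2
      fun n => integral_mul_divergence_le hu hβ (hv n) (hvβ n)
  have m1 : MemLp (fun x => y x - y₀ x) 2 (volume.restrict Ω) := hw.memLp
  have m2 : MemLp (fun x => y₀ x - yΩ x) 2 (volume.restrict Ω) := hg₀.memLp.sub hyΩ
  have hexp : ∫ x in Ω, (y x - yΩ x) ^ 2 = (∫ x in Ω, (y₀ x - yΩ x) ^ 2)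
      + 2 * (∫ x in Ω, (y x - y₀ x) * (y₀ x - yΩ x)) + ∫ x in Ω, (y x - y₀ x) ^ 2 := by
    have i3 : Integrable (fun x => (y x - y₀ x) * (y₀ x - yΩ x)) (volume.restrict Ω) :=
      m1.integrable_mul m2
    rw [← integral_const_mul, ← integral_add m2.integrable_sq (i3.const_mul 2),
      ← integral_add (by exact m2.integrable_sq.add (i3.const_mul 2)) m1.integrable_sq]
    congr 1
    funext x
    ring
  unfold objective
  rw [hexp, key, htv]
  linarith

/-- A strict form of optimality yields the global solution and its uniqueness. -/
theorem isOptimal_and_unique (hΩ : IsOpen Ω) {yΩ y₀ u₀ : EuclideanSpace ℝ (Fin N) → ℝ} {β : ℝ}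
    (h₀ : Admissible Ω y₀ u₀)
    (hle : ∀ y u : EuclideanSpace ℝ (Fin N) → ℝ, Admissible Ω y u →
      objective Ω yΩ β y₀ u₀ + 1 / 2 * ∫ x in Ω, (y x - y₀ x) ^ 2 ≤ objective Ω yΩ β y u) :
    IsOptimal Ω yΩ β y₀ u₀ ∧ ∀ y u : EuclideanSpace ℝ (Fin N) → ℝ, IsOptimal Ω yΩ β y u →
      y =ᵐ[volume.restrict Ω] y₀ ∧ u =ᵐ[volume.restrict Ω] u₀ := by
  refine ⟨⟨h₀, fun y u h => ?_⟩, fun y u h => ?_⟩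
  · have h1 := hle y u h
    have h2 : 0 ≤ ∫ x in Ω, (y x - y₀ x) ^ 2 := integral_nonneg fun x => sq_nonneg _
    linarith
  · have h1 := hle y u h.1
    have h2 := h.2 y₀ u₀ h₀
    have h3 : ∫ x in Ω, (y x - y₀ x) ^ 2 = 0 :=
      le_antisymm (by linarith) (integral_nonneg fun x => sq_nonneg _)
    obtain ⟨g, hg, -⟩ := h.1.2.2
    obtain ⟨g₀, hg₀, -⟩ := h₀.2.2
    rw [integral_eq_zero_iff_of_nonneg (fun x => sq_nonneg _)
      (by exact (hg.memLp.sub hg₀.memLp).integrable_sq)] at h3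
    have h4 : y =ᵐ[volume.restrict Ω] y₀ := by
      filter_upwards [h3] with x hx
      simpa [sub_eq_zero] using hx
    exact ⟨h4, h.1.2.rhs_ae_eq hΩ h₀.2 h4⟩

end

/-! ### Smooth cutoffs near a boundary point -/

theorem exists_abs_deriv_smoothTransition_le :
    ∃ K : ℝ, 0 ≤ K ∧ (∀ x, |deriv Real.smoothTransition x| ≤ K) ∧
      ∀ x, x ∉ Icc (0 : ℝ) 1 → deriv Real.smoothTransition x = 0 := by
  have h0 : ∀ x, x ∉ Icc (0 : ℝ) 1 → deriv Real.smoothTransition x = 0 := by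
    intro x hx
    rw [mem_Icc, not_and_or, not_le, not_le] at hx
    rcases hx with hx | hx
    · rw [(show Real.smoothTransition =ᶠ[𝓝 x] fun _ => 0 by
        filter_upwards [Iio_mem_nhds hx] with y hy
        exact Real.smoothTransition.zero_of_nonpos (le_of_lt hy)).deriv_eq, deriv_const]
    · rw [(show Real.smoothTransition =ᶠ[𝓝 x] fun _ => 1 by
        filter_upwards [Ioi_mem_nhds hx] with y hy
        exact Real.smoothTransition.one_of_one_le (le_of_lt hy)).deriv_eq, deriv_const]
  obtain ⟨K, hK⟩ := ((Real.smoothTransition.contDiff (n := 1)).continuous_deriv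
    (by simp)).bounded_above_of_compact_support
    (HasCompactSupport.intro isCompact_Icc h0)
  exact ⟨K, (norm_nonneg _).trans (hK 0), hK, h0⟩

/-- A smooth function of `t` that, for `n ≥ 1`, vanishes for `t ≤ 1 / n` and equals `1` for
`t ≥ 2 / n`. -/
noncomputable def smoothStep (n : ℕ) (t : ℝ) : ℝ := Real.smoothTransition (n * t - 1)

theorem smoothStep_nonneg (n : ℕ) (t : ℝ) : 0 ≤ smoothStep n t := Real.smoothTransition.nonneg _

theorem smoothStep_le_one (n : ℕ) (t : ℝ) : smoothStep n t ≤ 1 := Real.smoothTransition.le_one _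

theorem contDiff_smoothStep (n : ℕ) : ContDiff ℝ ∞ (smoothStep n) :=
  Real.smoothTransition.contDiff.comp (by fun_prop : ContDiff ℝ ∞ fun t : ℝ => n * t - 1)

theorem smoothStep_eq_zero {n : ℕ} {t : ℝ} (h : n * t ≤ 1) : smoothStep n t = 0 :=
  Real.smoothTransition.zero_of_nonpos (by linarith)

theorem smoothStep_eq_one {n : ℕ} {t : ℝ} (h : 2 ≤ n * t) : smoothStep n t = 1 :=
  Real.smoothTransition.one_of_one_le (by linarith)

theorem deriv_smoothStep (n : ℕ) (t : ℝ) :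
    deriv (smoothStep n) t = n * deriv Real.smoothTransition (n * t - 1) := by
  have h1 : HasDerivAt Real.smoothTransition (deriv Real.smoothTransition (n * t - 1)) (n * t - 1) :=
    ((Real.smoothTransition.contDiff (n := 1)).differentiable (by simp) _).hasDerivAt
  have h2 : HasDerivAt (fun t : ℝ => n * t - 1) (n : ℝ) t := by
    simpa using ((hasDerivAt_id t).const_mul (n : ℝ)).sub_const 1
  rw [mul_comm]
  exact (h1.comp t h2).deriv

theorem hasDerivAt_smoothStep (n : ℕ) (t : ℝ) :
    HasDerivAt (smoothStep n) (deriv (smoothStep n) t) t :=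
  ((contDiff_smoothStep n).differentiable (by simp) t).hasDerivAt

theorem deriv_smoothStep_eq_zero {n : ℕ} {t : ℝ} (h : t ≤ 0) : deriv (smoothStep n) t = 0 := by
  obtain ⟨K, -, -, h0⟩ := exists_abs_deriv_smoothTransition_le
  have h1 : n * t ≤ 0 := mul_nonpos_of_nonneg_of_nonpos (by positivity) h
  rw [deriv_smoothStep, h0 _ (fun h => by linarith [h.1]), mul_zero]

/-- The cutoffs satisfy `t |∂_t s_n(t)| ≤ K`, uniformly in `n`. -/
theorem exists_mul_abs_deriv_smoothStep_le :
    ∃ K : ℝ, 0 ≤ K ∧ ∀ n : ℕ, ∀ t : ℝ, 0 ≤ t → t * |deriv (smoothStep n) t| ≤ K ∧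
      t ^ 2 * |deriv (smoothStep n) t| ≤ K * t := by
  obtain ⟨K, hK0, hK, h0⟩ := exists_abs_deriv_smoothTransition_le
  have key : ∀ n : ℕ, ∀ t : ℝ, 0 ≤ t → t * |deriv (smoothStep n) t| ≤ 2 * K := by
    intro n t ht
    rw [deriv_smoothStep, abs_mul, Nat.abs_cast]
    by_cases h : n * t - 1 ∈ Icc (0 : ℝ) 1
    · have h1 : n * t ≤ 2 := by linarith [h.2]
      calc t * (n * |deriv Real.smoothTransition (n * t - 1)|)
          = (n * t) * |deriv Real.smoothTransition (n * t - 1)| := by ring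
        _ ≤ 2 * K := mul_le_mul h1 (hK _) (abs_nonneg _) (by norm_num)
    · rw [h0 _ h]; simpa using hK0
  refine ⟨2 * K, by positivity, fun n t ht => ⟨key n t ht, ?_⟩⟩
  have := mul_le_mul_of_nonneg_left (key n t ht) ht
  nlinarith

theorem eventually_smoothStep_eq_one {t : ℝ} (ht : 0 < t) :
    ∀ᶠ n : ℕ in atTop, smoothStep n t = 1 ∧ deriv (smoothStep n) t = 0 := by
  obtain ⟨K, -, -, h0⟩ := exists_abs_deriv_smoothTransition_le
  filter_upwards [(tendsto_natCast_atTop_atTop (R := ℝ)).eventually_gt_atTop (2 / t)] with n hn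
  rw [div_lt_iff₀ ht] at hn
  refine ⟨smoothStep_eq_one hn.le, ?_⟩
  rw [deriv_smoothStep, h0 _ (fun h => by linarith [h.2]), mul_zero]

/-! ### Radial test functions on the annulus -/

theorem mem_annulus {R : ℝ} {x : EuclideanSpace ℝ (Fin 2)} :
    x ∈ annulus R ↔ ‖x‖ ∈ Ioo R (2 * R) := by
  simp [annulus, and_comm]

theorem isOpen_annulus (R : ℝ) : IsOpen (annulus R) :=
  Metric.isOpen_ball.sdiff Metric.isClosed_closedBall

theorem annulus_subset_ball (R : ℝ) : annulus R ⊆ Metric.ball 0 (2 * R) := sdiff_subset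

theorem volume_annulus_ne_top (R : ℝ) : volume (annulus R) ≠ ⊤ :=
  ((measure_mono (annulus_subset_ball R)).trans_lt measure_ball_lt_top).ne

theorem ne_zero_of_norm_pos {x : EuclideanSpace ℝ (Fin 2)} (h : 0 < ‖x‖) : x ≠ 0 :=
  norm_pos_iff.1 h

theorem contDiffAt_gradient_radius {x : EuclideanSpace ℝ (Fin 2)} (hx : x ≠ 0)
    {k : WithTop ℕ∞} : ContDiffAt ℝ k (gradient radius) x := by
  rw [show gradient radius = fun x => ‖x‖⁻¹ • x from funext gradient_radius]
  exact ((contDiffAt_norm ℝ hx).inv (by simpa using hx)).smul contDiffAt_id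

theorem norm_gradient_radius {x : EuclideanSpace ℝ (Fin 2)} (hx : x ≠ 0) :
    ‖gradient radius x‖ = 1 := by
  rw [gradient_radius, norm_smul, norm_inv, norm_norm, inv_mul_cancel₀ (by simpa using hx)]

theorem norm_gradient_radius_le (x : EuclideanSpace ℝ (Fin 2)) : ‖gradient radius x‖ ≤ 1 := by
  by_cases hx : x = 0
  · simp [hx, gradient_radius]
  · exact (norm_gradient_radius hx).le

theorem isTest_annulus {F : Type*} [NormedAddCommGroup F] [NormedSpace ℝ F] {R δ : ℝ} (hδ : 0 < δ)
    {k : WithTop ℕ∞} {f : EuclideanSpace ℝ (Fin 2) → F}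
    (hf : ∀ x ∈ annulus R, ContDiffAt ℝ k f x)
    (h0 : ∀ x, ‖x‖ ∉ Icc (R + δ) (2 * R - δ) → f x = 0) : IsTest k (annulus R) f := by
  have hs : tsupport f ⊆ {x | ‖x‖ ∈ Icc (R + δ) (2 * R - δ)} :=
    closure_minimal (fun x hx => by
      by_contra h
      exact hx (h0 x h)) (isClosed_Icc.preimage continuous_norm)
  have hsΩ : tsupport f ⊆ annulus R := fun x hx => by
    have := hs hx
    exact mem_annulus.2 ⟨by linarith [this.1], by linarith [this.2]⟩
  refine ⟨contDiff_iff_contDiffAt.2 fun x => ?_, ?_, hsΩ⟩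
  · by_cases hx : x ∈ tsupport f
    · exact hf x (hsΩ hx)
    · exact contDiffAt_const.congr_of_eventuallyEq (notMem_tsupport_iff_eventuallyEq.1 hx)
  · exact (isCompact_closedBall (0 : EuclideanSpace ℝ (Fin 2)) (2 * R - δ)).of_isClosed_subset
      (isClosed_tsupport f) fun x hx => by simpa using (hs hx).2

/-- Radial profiles `fₙ` that vanish at the two boundary radii, with uniformly bounded derivatives,
can be cut off near the boundary so that derivatives stay bounded and pointwise limits in the open
annulus are kept. -/
theorem exists_radial_approx {R L : ℝ} (hR : 0 < R) {f f' : ℕ → ℝ → ℝ} {F F' : ℝ → ℝ}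
    (hf : ∀ n, ∀ r ∈ Ioo R (2 * R), ContDiffAt ℝ ∞ (f n) r)
    (hf' : ∀ n, ∀ r ∈ Icc R (2 * R), HasDerivAt (f n) (f' n r) r)
    (hL : ∀ n, ∀ r ∈ Icc R (2 * R), |f' n r| ≤ L)
    (hfR : ∀ n, f n R = 0) (hf2R : ∀ n, f n (2 * R) = 0)
    (hF : ∀ r ∈ Ioo R (2 * R), Tendsto (fun n => f n r) atTop (𝓝 (F r)))
    (hF' : ∀ r ∈ Ioo R (2 * R), Tendsto (fun n => f' n r) atTop (𝓝 (F' r))) :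
    ∃ g : ℕ → ℝ → ℝ, (∀ n r, |g n r| ≤ |f n r|) ∧
      (∀ r ∈ Ioo R (2 * R), Tendsto (fun n => g n r) atTop (𝓝 (F r))) ∧
      (∀ n, IsTest ∞ (annulus R) fun x => g n ‖x‖) ∧
      (∀ n, IsTest ∞ (annulus R) fun x => g n ‖x‖ • gradient radius x) ∧
      BddTendsto (annulus R) (fun n x => g n ‖x‖) (fun x => F ‖x‖) ∧
      BddTendsto (annulus R) (fun n => gradient fun x => g n ‖x‖)
        (fun x => F' ‖x‖ • gradient radius x) ∧
      BddTendsto (annulus R) (fun n x => g n ‖x‖ • gradient radius x)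
        (fun x => F ‖x‖ • gradient radius x) ∧
      BddTendsto (annulus R) (fun n => divergence fun x => g n ‖x‖ • gradient radius x)
        (fun x => F' ‖x‖ + F ‖x‖ / ‖x‖) := by
  obtain ⟨K, hK0, hK⟩ := exists_mul_abs_deriv_smoothStep_le
  have hL0 : 0 ≤ L := (abs_nonneg _).trans (hL 0 R ⟨le_rfl, by linarith⟩)
  -- linear decay at the boundary
  have hmv : ∀ n, ∀ s ∈ Icc R (2 * R), ∀ r ∈ Icc R (2 * R), |f n r - f n s| ≤ L * |r - s| :=
    fun n s hs r hr => (convex_Icc R (2 * R)).norm_image_sub_le_of_norm_hasDerivWithin_le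
      (fun t ht => (hf' n t ht).hasDerivWithinAt) (hL n) hs hr
  have hd1 : ∀ n, ∀ r ∈ Ioo R (2 * R), |f n r| ≤ L * (r - R) := fun n r hr => by
    have := hmv n R ⟨le_rfl, by linarith⟩ r (Ioo_subset_Icc_self hr)
    rwa [hfR, sub_zero, abs_of_pos (sub_pos.2 hr.1)] at this
  have hd2 : ∀ n, ∀ r ∈ Ioo R (2 * R), |f n r| ≤ L * (2 * R - r) := fun n r hr => by
    have := hmv n (2 * R) ⟨by linarith, le_rfl⟩ r (Ioo_subset_Icc_self hr)
    rwa [hf2R, sub_zero, abs_sub_comm, abs_of_pos (sub_pos.2 hr.2)] at this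
  obtain ⟨χ, hχ⟩ : ∃ χ : ℕ → ℝ → ℝ, χ = fun n r => smoothStep n (r - R) * smoothStep n (2 * R - r) :=
    ⟨_, rfl⟩
  obtain ⟨χ', hχ'⟩ : ∃ χ' : ℕ → ℝ → ℝ, χ' = fun n r =>
    deriv (smoothStep n) (r - R) * smoothStep n (2 * R - r)
      - smoothStep n (r - R) * deriv (smoothStep n) (2 * R - r) := ⟨_, rfl⟩
  have hχ0 : ∀ n r, 0 ≤ χ n r := fun n r => by
    rw [hχ]; exact mul_nonneg (smoothStep_nonneg _ _) (smoothStep_nonneg _ _)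
  have hχ1 : ∀ n r, χ n r ≤ 1 := fun n r => by
    rw [hχ]; exact mul_le_one₀ (smoothStep_le_one _ _) (smoothStep_nonneg _ _) (smoothStep_le_one _ _)
  have hχd : ∀ n r, HasDerivAt (χ n) (χ' n r) r := fun n r => by
    rw [hχ, hχ']
    have h1 := (hasDerivAt_smoothStep n (r - R)).comp r ((hasDerivAt_id r).sub_const R)
    have h2 := (hasDerivAt_smoothStep n (2 * R - r)).comp r ((hasDerivAt_id r).const_sub (2 * R))
    have h3 := h1.mul h2
    simp only [mul_one, mul_neg, Function.comp_def, id] at h3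
    rw [← sub_eq_add_neg] at h3
    exact h3
  have hχc : ∀ n, ContDiff ℝ ∞ (χ n) := fun n => by
    rw [hχ]
    exact ((contDiff_smoothStep n).comp (by fun_prop : ContDiff ℝ ∞ fun r : ℝ => r - R)).mul
      ((contDiff_smoothStep n).comp (by fun_prop : ContDiff ℝ ∞ fun r : ℝ => 2 * R - r))
  have hχe : ∀ r ∈ Ioo R (2 * R), ∀ᶠ n in atTop, χ n r = 1 ∧ χ' n r = 0 := fun r hr => by
    filter_upwards [eventually_smoothStep_eq_one (sub_pos.2 hr.1),
      eventually_smoothStep_eq_one (sub_pos.2 hr.2)] with n h1 h2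
    simp [hχ, hχ', h1, h2]
  have hχz : ∀ n : ℕ, ∀ r, r ∉ Icc (R + 1 / (n + 1)) (2 * R - 1 / (n + 1)) → χ n r = 0 := by
    intro n r hr
    have hn : (0 : ℝ) < n + 1 := by positivity
    have key : ∀ t : ℝ, t < 1 / (n + 1) → smoothStep n t = 0 := by
      intro t ht
      apply smoothStep_eq_zero
      rw [lt_div_iff₀ hn] at ht
      rcases le_total 0 t with h | h
      · nlinarith
      · exact (mul_nonpos_of_nonneg_of_nonpos (by positivity) h).trans zero_le_one
    rw [mem_Icc, not_and_or, not_le, not_le] at hr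
    rcases hr with h | h
    · simp [hχ, key (r - R) (by linarith)]
    · simp [hχ, key (2 * R - r) (by linarith)]
  -- the growth of `χ'`, inverse to the distance to the boundary, is compensated by the decay of `f`
  have hχf : ∀ n, ∀ r ∈ Ioo R (2 * R), |χ' n r * f n r| ≤ 2 * K * L := by
    intro n r hr
    have h1 := (hK n (r - R) (sub_pos.2 hr.1).le).1
    have h2 := (hK n (2 * R - r) (sub_pos.2 hr.2).le).1
    have e1 : |deriv (smoothStep n) (r - R) * smoothStep n (2 * R - r) * f n r| ≤ K * L := by
      rw [abs_mul, abs_mul, abs_of_nonneg (smoothStep_nonneg _ _)]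
      calc _ ≤ |deriv (smoothStep n) (r - R)| * 1 * (L * (r - R)) := by
            gcongr
            · exact smoothStep_le_one _ _
            · exact hd1 n r hr
        _ = (r - R) * |deriv (smoothStep n) (r - R)| * L := by ring
        _ ≤ K * L := by gcongr
    have e2 : |smoothStep n (r - R) * deriv (smoothStep n) (2 * R - r) * f n r| ≤ K * L := by
      rw [abs_mul, abs_mul, abs_of_nonneg (smoothStep_nonneg _ _)]
      calc _ ≤ 1 * |deriv (smoothStep n) (2 * R - r)| * (L * (2 * R - r)) := by
            gcongr
            · exact smoothStep_le_one _ _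
            · exact hd2 n r hr
        _ = (2 * R - r) * |deriv (smoothStep n) (2 * R - r)| * L := by ring
        _ ≤ K * L := by gcongr
    rw [hχ']
    simp only [sub_mul]
    refine (abs_sub _ _).trans ?_
    linarith
  have hpos : ∀ x ∈ annulus R, x ≠ 0 ∧ 0 < ‖x‖ ∧ ‖x‖ ∈ Ioo R (2 * R) := fun x hx => by
    have h := mem_annulus.1 hx
    exact ⟨ne_zero_of_norm_pos (hR.trans h.1), hR.trans h.1, h⟩
  have hgd : ∀ n, ∀ r ∈ Ioo R (2 * R),
      HasDerivAt (fun r => χ n r * f n r) (χ' n r * f n r + χ n r * f' n r) r :=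
    fun n r hr => (hχd n r).mul (hf' n r (Ioo_subset_Icc_self hr))
  have hg1 : ∀ n, ∀ r ∈ Ioo R (2 * R), |χ' n r * f n r + χ n r * f' n r| ≤ 2 * K * L + L := by
    intro n r hr
    refine (abs_add_le _ _).trans (add_le_add (hχf n r hr) ?_)
    rw [abs_mul, abs_of_nonneg (hχ0 n r)]
    exact (mul_le_mul (hχ1 n r) (hL n r (Ioo_subset_Icc_self hr)) (abs_nonneg _)
      zero_le_one).trans (one_mul L).le
  have hg0 : ∀ n r, |χ n r * f n r| ≤ |f n r| := fun n r => by
    rw [abs_mul, abs_of_nonneg (hχ0 n r)]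
    exact mul_le_of_le_one_left (abs_nonneg _) (hχ1 n r)
  have hg0' : ∀ n, ∀ r ∈ Ioo R (2 * R), |χ n r * f n r| ≤ L * R := fun n r hr =>
    (hg0 n r).trans ((hd1 n r hr).trans (mul_le_mul_of_nonneg_left (by linarith [hr.2]) hL0))
  have ht0 : ∀ r ∈ Ioo R (2 * R), Tendsto (fun n => χ n r * f n r) atTop (𝓝 (F r)) :=
    fun r hr => (hF r hr).congr' (by
      filter_upwards [hχe r hr] with n hn
      rw [hn.1, one_mul])
  have ht1 : ∀ r ∈ Ioo R (2 * R),
      Tendsto (fun n => χ' n r * f n r + χ n r * f' n r) atTop (𝓝 (F' r)) :=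
    fun r hr => (hF' r hr).congr' (by
      filter_upwards [hχe r hr] with n hn
      rw [hn.1, hn.2, one_mul, zero_mul, zero_add])
  have hgc : ∀ n, ∀ x ∈ annulus R, ContDiffAt ℝ ∞ (fun x => χ n ‖x‖ * f n ‖x‖) x := fun n x hx => by
    obtain ⟨h1, -, h3⟩ := hpos x hx
    exact ((hχc n).contDiffAt.mul (hf n _ h3)).comp x (contDiffAt_norm ℝ h1)
  have hδ : ∀ n : ℕ, (0 : ℝ) < 1 / (n + 1) := fun n => by positivity
  have hgrad : ∀ n, ∀ x ∈ annulus R, gradient (fun x => χ n ‖x‖ * f n ‖x‖) x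
      = (χ' n ‖x‖ * f n ‖x‖ + χ n ‖x‖ * f' n ‖x‖) • gradient radius x := fun n x hx =>
    gradient_radial (hpos x hx).1 (hgd n _ (hpos x hx).2.2)
  have hdiv : ∀ n, ∀ x ∈ annulus R,
      divergence (fun x => (χ n ‖x‖ * f n ‖x‖) • gradient radius x) x
      = (χ' n ‖x‖ * f n ‖x‖ + χ n ‖x‖ * f' n ‖x‖) + χ n ‖x‖ * f n ‖x‖ / ‖x‖ := fun n x hx =>
    divergence_radial (hpos x hx).1 (hgd n _ (hpos x hx).2.2)
  refine ⟨fun n r => χ n r * f n r, hg0, ht0, fun n => isTest_annulus (hδ n) (hgc n) fun x hx => ?_,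
    fun n => isTest_annulus (hδ n) (fun x hx => ?_) fun x hx => ?_, ⟨⟨L * R, fun n x hx => ?_⟩, ?_⟩,
    ⟨⟨2 * K * L + L, fun n x hx => ?_⟩, fun x hx => ?_⟩,
    ⟨⟨L * R, fun n x hx => ?_⟩, fun x hx => ?_⟩,
    ⟨⟨2 * K * L + L + L, fun n x hx => ?_⟩, fun x hx => ?_⟩⟩
  · simp only [hχz n _ hx, zero_mul]
  · exact (hgc n x hx).smul (contDiffAt_gradient_radius (hpos x hx).1)
  · simp only [hχz n _ hx, zero_mul, zero_smul]
  · exact hg0' n _ (hpos x hx).2.2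
  · exact fun x hx => ht0 _ (hpos x hx).2.2
  · rw [hgrad n x hx, norm_smul, norm_gradient_radius (hpos x hx).1, mul_one]
    exact hg1 n _ (hpos x hx).2.2
  · exact ((ht1 _ (hpos x hx).2.2).smul_const _).congr fun n => (hgrad n x hx).symm
  · rw [norm_smul, norm_gradient_radius (hpos x hx).1, mul_one]
    exact hg0' n _ (hpos x hx).2.2
  · exact (ht0 _ (hpos x hx).2.2).smul_const _
  · obtain ⟨-, h2, h3⟩ := hpos x hx
    rw [hdiv n x hx]
    refine (norm_add_le _ _).trans (add_le_add (hg1 n _ h3) ?_)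
    rw [norm_div, norm_norm, div_le_iff₀ h2]
    exact (hg0' n _ h3).trans (mul_le_mul_of_nonneg_left h3.1.le hL0)
  · exact ((ht1 _ (hpos x hx).2.2).add ((ht0 _ (hpos x hx).2.2).div_const _)).congr
      fun n => (hdiv n x hx).symm

/-! ### Geometry of the annulus -/

theorem norm_mem_of_mem_closure_annulus {R : ℝ} {x : EuclideanSpace ℝ (Fin 2)}
    (hx : x ∈ closure (annulus R)) : ‖x‖ ∈ Icc R (2 * R) :=
  closure_minimal (fun y h => (Ioo_subset_Icc_self (mem_annulus.1 h) : ‖y‖ ∈ Icc R (2 * R)))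
    (isClosed_Icc.preimage continuous_norm) hx

theorem norm_eq_of_mem_frontier_annulus {R : ℝ} {x : EuclideanSpace ℝ (Fin 2)}
    (hx : x ∈ frontier (annulus R)) : ‖x‖ = R ∨ ‖x‖ = 2 * R := by
  rw [(isOpen_annulus R).frontier_eq] at hx
  have h1 := norm_mem_of_mem_closure_annulus hx.1
  by_contra h
  rw [not_or] at h
  exact hx.2 (mem_annulus.2 ⟨lt_of_le_of_ne h1.1 (Ne.symm h.1), lt_of_le_of_ne h1.2 h.2⟩)

theorem memLp_annulus {F : Type*} [NormedAddCommGroup F] {R : ℝ} {f : EuclideanSpace ℝ (Fin 2) → F}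
    (hf : ∀ x : EuclideanSpace ℝ (Fin 2), ‖x‖ ∈ Icc R (2 * R) → ContinuousAt f x) (q : ℝ≥0∞) :
    MemLp f q (volume.restrict (annulus R)) := by
  have : IsFiniteMeasure (volume.restrict (annulus R)) :=
    ⟨by simpa using (volume_annulus_ne_top R).lt_top⟩
  have hsub : ∀ x ∈ annulus R, ‖x‖ ∈ Icc R (2 * R) := fun x hx =>
    Ioo_subset_Icc_self (mem_annulus.1 hx)
  have hK : IsCompact {x : EuclideanSpace ℝ (Fin 2) | ‖x‖ ∈ Icc R (2 * R)} :=
    (isCompact_closedBall (0 : EuclideanSpace ℝ (Fin 2)) (2 * R)).of_isClosed_subset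
      (isClosed_Icc.preimage continuous_norm) fun x hx => by simpa using hx.2
  obtain ⟨C, hC⟩ := hK.exists_bound_of_continuousOn fun x hx => (hf x hx).continuousWithinAt
  refine MemLp.of_bound (ContinuousOn.aestronglyMeasurable (fun x hx =>
    (hf x (hsub x hx)).continuousWithinAt) (isOpen_annulus R).measurableSet) C ?_
  exact ae_restrict_of_forall_mem (isOpen_annulus R).measurableSet fun x hx => hC x (hsub x hx)

theorem BddTendsto.congr_right {α E : Type*} [NormedAddCommGroup E] {Ω : Set α} {F : ℕ → α → E}
    {f g : α → E} (h : BddTendsto Ω F f) (hfg : ∀ x ∈ Ω, f x = g x) : BddTendsto Ω F g :=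
  ⟨h.bdd, fun x hx => hfg x hx ▸ h.tendsto x hx⟩

theorem contDiffAt_deriv {f : ℝ → ℝ} {r : ℝ} (hf : ContDiffAt ℝ ∞ f r) :
    ContDiffAt ℝ ∞ (deriv f) r :=
  (hf.fderiv_right (m := ∞) (by simp)).clm_apply (contDiffAt_const (c := (1 : ℝ)))

/-! ### The dual field and the adjoint state -/

/-- The radial profile `ĥ' + ĥ / r` of the adjoint state. -/
noncomputable def pHat (R β r : ℝ) : ℝ := deriv (hHat R β) r + r⁻¹ * hHat R β r

theorem contDiff_hHat (R β : ℝ) : ContDiff ℝ ∞ (hHat R β) := by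
  unfold hHat; fun_prop

theorem hasDerivAt_hHat (R β r : ℝ) :
    HasDerivAt (hHat R β) (β / 2 * (-Real.sin (2 * Real.pi / R * r) * (2 * Real.pi / R))) r := by
  have := (((Real.hasDerivAt_cos (2 * Real.pi / R * r)).comp r
    ((hasDerivAt_id r).const_mul (2 * Real.pi / R))).sub_const 1).const_mul (β / 2)
  simp only [mul_one] at this
  exact this

theorem contDiffAt_pHat (R β : ℝ) {r : ℝ} (hr : 0 < r) : ContDiffAt ℝ ∞ (pHat R β) r :=
  (contDiffAt_deriv (contDiff_hHat R β).contDiffAt).add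
    ((contDiffAt_inv ℝ hr.ne').mul (contDiff_hHat R β).contDiffAt)

theorem hHat_left {R : ℝ} (hR : 0 < R) (β : ℝ) : hHat R β R = 0 := by
  simp [hHat, hR.ne']

theorem hHat_right {R : ℝ} (hR : 0 < R) (β : ℝ) : hHat R β (2 * R) = 0 := by
  rw [hHat, show 2 * Real.pi / R * (2 * R) = 2 * Real.pi + 2 * Real.pi by field_simp; ring,
    Real.cos_add_two_pi, Real.cos_two_pi, sub_self, mul_zero]

theorem hHat_mid {R : ℝ} (hR : 0 < R) (β : ℝ) : hHat R β (3 * R / 2) = -β := by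
  rw [hHat, show 2 * Real.pi / R * (3 * R / 2) = Real.pi + 2 * Real.pi by field_simp; ring,
    Real.cos_add_two_pi, Real.cos_pi]
  ring

theorem pHat_left {R : ℝ} (hR : 0 < R) (β : ℝ) : pHat R β R = 0 := by
  rw [pHat, hHat_left hR, (hasDerivAt_hHat R β R).deriv]
  simp [hR.ne']

theorem pHat_right {R : ℝ} (hR : 0 < R) (β : ℝ) : pHat R β (2 * R) = 0 := by
  rw [pHat, hHat_right hR, (hasDerivAt_hHat R β _).deriv,
    show 2 * Real.pi / R * (2 * R) = 2 * Real.pi + 2 * Real.pi by field_simp; ring,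
    Real.sin_add_two_pi, Real.sin_two_pi]
  simp

theorem abs_hHat_le (R : ℝ) {β : ℝ} (hβ : 0 < β) (r : ℝ) : |hHat R β r| ≤ β := by
  rw [hHat, abs_le]
  have h1 := Real.neg_one_le_cos (2 * Real.pi / R * r)
  have h2 := Real.cos_le_one (2 * Real.pi / R * r)
  constructor <;> nlinarith

theorem pBar_eq {R β : ℝ} {x : EuclideanSpace ℝ (Fin 2)} (hx : x ≠ 0) :
    pBar R β x = pHat R β ‖x‖ := by
  have h := divergence_radial hx ((contDiff_hHat R β).differentiable (by simp) ‖x‖).hasDerivAt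
  unfold pHat
  rw [mul_comm, ← div_eq_mul_inv]
  exact h

theorem pBar_eventuallyEq {R β : ℝ} {x : EuclideanSpace ℝ (Fin 2)} (hx : x ≠ 0) :
    pBar R β =ᶠ[𝓝 x] fun y => pHat R β ‖y‖ := by
  filter_upwards [isOpen_ne.mem_nhds hx] with y hy
  exact pBar_eq hy

theorem contDiffAt_pBar {R β : ℝ} {x : EuclideanSpace ℝ (Fin 2)} (hx : x ≠ 0) :
    ContDiffAt ℝ ∞ (pBar R β) x :=
  ((contDiffAt_pHat R β (norm_pos_iff.2 hx)).comp x (contDiffAt_norm ℝ hx)).congr_of_eventuallyEq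
    (pBar_eventuallyEq hx)

theorem contDiffAt_hBar {R β : ℝ} {x : EuclideanSpace ℝ (Fin 2)} (hx : x ≠ 0) :
    ContDiffAt ℝ ∞ (hBar R β) x :=
  ((contDiff_hHat R β).contDiffAt.comp x (contDiffAt_norm ℝ hx)).smul
    (contDiffAt_gradient_radius hx)

/-- The radial form of `Δ p̄`. -/
noncomputable def lapHat (R β r : ℝ) : ℝ := deriv (deriv (pHat R β)) r + deriv (pHat R β) r / r

theorem laplacian_pBar {R β : ℝ} {x : EuclideanSpace ℝ (Fin 2)} (hx : x ≠ 0) :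
    Laplacian.laplacian (pBar R β) x = lapHat R β ‖x‖ := by
  have hn := norm_pos_iff.2 hx
  rw [(InnerProductSpace.laplacian_congr_nhds (pBar_eventuallyEq hx)).eq_of_nhds]
  exact laplacian_radial hx (contDiffAt_infty.1 (contDiffAt_pHat R β hn) 2)
    (fun r hr => ((contDiffAt_pHat R β hr).differentiableAt (by simp)).hasDerivAt)
    ((contDiffAt_deriv (contDiffAt_pHat R β hn)).differentiableAt (by simp)).hasDerivAt

/-! ### The optimal state -/

/-- The difference of the two branches of `ŷ`. It vanishes to second order at `r = 3R/2`. -/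
noncomputable def yJump (R r : ℝ) : ℝ :=
  -(r ^ 2 / 4) + 9 * R ^ 2 / 8 * Real.log (r / (2 * R)) + constB R

/-- The derivative of `yJump`. -/
noncomputable def yJump' (R r : ℝ) : ℝ := -(r / 2) + 9 * R ^ 2 / 8 / r

/-- The derivative of `ŷ`. -/
noncomputable def yHat' (R r : ℝ) : ℝ :=
  constC R / r + if r < 3 * R / 2 then yJump' R r else 0

/-- The choice of `A` and `C` that makes `ŷ` differentiable at `r = 3R/2`. -/
theorem constA_eq (R : ℝ) : constA R = constC R + 9 * R ^ 2 / 8 := by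
  have h4 : Real.log (1 / 4) = -(2 * Real.log 2) := by
    rw [show (1 : ℝ) / 4 = (2 ^ 2)⁻¹ by norm_num, Real.log_inv, Real.log_pow]; simp
  have h34 : Real.log (3 / 4) = Real.log 3 - 2 * Real.log 2 := by
    rw [Real.log_div (by norm_num) (by norm_num), show (4 : ℝ) = 2 ^ 2 by norm_num, Real.log_pow]
    simp
  have h32 : Real.log (3 / 2) = Real.log 3 - Real.log 2 :=
    Real.log_div (by norm_num) (by norm_num)
  have h2 : Real.log 2 ≠ 0 := (Real.log_pos (by norm_num)).ne'
  rw [constA, constC, h4, h34, h32]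
  field_simp
  ring

theorem yHat_eq (R r : ℝ) : yHat R r = constC R * Real.log (r / (2 * R))
    + if r < 3 * R / 2 then yJump R r else 0 := by
  unfold yHat yJump
  split_ifs
  · rw [constA_eq]; ring
  · ring

theorem yJump_mid {R : ℝ} (hR : 0 < R) : yJump R (3 * R / 2) = 0 := by
  rw [yJump, constB, show 3 * R / 2 / (2 * R) = 3 / 4 by field_simp; norm_num]
  ring

theorem yHat_left {R : ℝ} (hR : 0 < R) : yHat R R = 0 := by
  have h4 : Real.log (1 / 4) = -(2 * Real.log 2) := by
    rw [show (1 : ℝ) / 4 = (2 ^ 2)⁻¹ by norm_num, Real.log_inv, Real.log_pow]; simp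
  have h12 : Real.log (1 / 2) = -Real.log 2 := by
    rw [one_div, Real.log_inv]
  have h2 : Real.log 2 ≠ 0 := (Real.log_pos (by norm_num)).ne'
  rw [yHat, if_pos (by linarith), show R / (2 * R) = 1 / 2 by field_simp, constA, constB, h4, h12]
  field_simp
  ring

theorem yHat_right {R : ℝ} (hR : 0 < R) : yHat R (2 * R) = 0 := by
  rw [yHat, if_neg (by linarith), div_self (by positivity), Real.log_one, mul_zero]

theorem hasDerivAt_log_div {R r : ℝ} (hR : 0 < R) (hr : 0 < r) :
    HasDerivAt (fun r => Real.log (r / (2 * R))) r⁻¹ r := by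
  have := (Real.hasDerivAt_log (x := r / (2 * R)) (by positivity)).comp r
    ((hasDerivAt_id r).div_const (2 * R))
  convert! this using 1
  field_simp

theorem hasDerivAt_yJump {R r : ℝ} (hR : 0 < R) (hr : 0 < r) :
    HasDerivAt (yJump R) (yJump' R r) r := by
  have h := ((((hasDerivAt_pow 2 r).div_const 4).neg).add
    ((hasDerivAt_log_div hR hr).const_mul (9 * R ^ 2 / 8))).add_const (constB R)
  convert! h using 1
  unfold yJump'
  simp
  ring

theorem yJump'_eq {R r : ℝ} (hr : 0 < r) :
    yJump' R r = (3 * R / 2 - r) * (3 * R / 2 + r) / (2 * r) := by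
  unfold yJump'
  field_simp
  ring

theorem abs_yJump'_le {R r : ℝ} (hR : 0 < R) (hr : r ∈ Icc R (2 * R)) :
    |yJump' R r| ≤ 2 * |3 * R / 2 - r| := by
  have hr0 : 0 < r := hR.trans_le hr.1
  rw [yJump'_eq hr0, abs_div, abs_mul, abs_of_pos (by linarith : 0 < 3 * R / 2 + r),
    abs_of_pos (by linarith : 0 < 2 * r), div_le_iff₀ (by linarith)]
  have := abs_nonneg (3 * R / 2 - r)
  have h2 := hr.1
  nlinarith

theorem abs_yJump_le {R r : ℝ} (hR : 0 < R) (hr : r ∈ Icc R (2 * R)) :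
    |yJump R r| ≤ 2 * |3 * R / 2 - r| ^ 2 := by
  have hm : 3 * R / 2 ∈ Icc R (2 * R) := ⟨by linarith, by linarith⟩
  have hsub : uIcc (3 * R / 2) r ⊆ Icc R (2 * R) := uIcc_subset_Icc hm hr
  have h := (convex_uIcc (3 * R / 2) r).norm_image_sub_le_of_norm_hasDerivWithin_le
    (f := yJump R) (f' := yJump' R) (C := 2 * |3 * R / 2 - r|)
    (fun t ht => (hasDerivAt_yJump hR (hR.trans_le (hsub ht).1)).hasDerivWithinAt)
    (fun t ht => (abs_yJump'_le hR (hsub ht)).trans (by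
      have : |t - 3 * R / 2| ≤ |r - 3 * R / 2| := abs_sub_left_of_mem_uIcc ht
      rw [abs_sub_comm t, abs_sub_comm r] at this
      linarith)) left_mem_uIcc right_mem_uIcc
  rw [yJump_mid hR, sub_zero, Real.norm_eq_abs, Real.norm_eq_abs, abs_sub_comm r] at h
  linarith [h, sq (|3 * R / 2 - r|)]

theorem hasDerivAt_yHat {R r : ℝ} (hR : 0 < R) (hr : 0 < r) :
    HasDerivAt (yHat R) (yHat' R r) r := by
  have e : yHat R = fun r => constC R * Real.log (r / (2 * R))
    + if r < 3 * R / 2 then yJump R r else 0 := funext (yHat_eq R)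
  rw [e, yHat', div_eq_mul_inv (constC R)]
  refine ((hasDerivAt_log_div hR hr).const_mul _).add ?_
  rcases lt_trichotomy r (3 * R / 2) with h | h | h
  · rw [if_pos h]
    refine (hasDerivAt_yJump hR hr).congr_of_eventuallyEq ?_
    filter_upwards [Iio_mem_nhds h] with s hs
    exact if_pos hs
  · subst h
    rw [if_neg (lt_irrefl _)]
    have h1 : HasDerivWithinAt (fun r => if r < 3 * R / 2 then yJump R r else 0) 0
        (Iic (3 * R / 2)) (3 * R / 2) := by
      have h2 := hasDerivAt_yJump hR hr
      rw [show yJump' R (3 * R / 2) = 0 by rw [yJump'_eq hr]; simp] at h2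
      refine h2.hasDerivWithinAt.congr (fun s hs => ?_) (by simp [yJump_mid hR])
      rcases (mem_Iic.1 hs).lt_or_eq with h | h
      · exact if_pos h
      · rw [h, if_neg (lt_irrefl _), yJump_mid hR]
    have h3 : HasDerivWithinAt (fun r => if r < 3 * R / 2 then yJump R r else 0) 0
        (Ici (3 * R / 2)) (3 * R / 2) :=
      (hasDerivWithinAt_const _ _ (0 : ℝ)).congr (fun s hs => if_neg (not_lt.2 hs)) (by simp)
    have := h1.union h3
    rwa [Iic_union_Ici, hasDerivWithinAt_univ] at this
  · rw [if_neg h.not_gt]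
    refine (hasDerivAt_const r (0 : ℝ)).congr_of_eventuallyEq ?_
    filter_upwards [Ioi_mem_nhds h] with s hs
    exact if_neg (not_lt.2 (le_of_lt hs))

theorem continuousAt_yHat' {R r : ℝ} (hR : 0 < R) (hr : 0 < r) : ContinuousAt (yHat' R) r := by
  -- as `yJump'` vanishes at `3R/2`, cutting it off there is the same as stopping its argument there
  have e : yHat' R = fun r => constC R / r
      + (-(min r (3 * R / 2) / 2) + 9 * R ^ 2 / 8 / min r (3 * R / 2)) := by
    funext s
    rw [yHat']
    split_ifs with h
    · rw [min_eq_left h.le]; rfl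
    · rw [min_eq_right (not_lt.1 h)]
      congr 1
      field_simp
      ring
  have hm : min r (3 * R / 2) ≠ 0 := (lt_min hr (by positivity)).ne'
  have hc : ContinuousAt (fun r : ℝ => min r (3 * R / 2)) r := by fun_prop
  rw [e]
  exact (continuousAt_const.div continuousAt_id hr.ne').add
    ((hc.div_const 2).neg.add (continuousAt_const.div hc hm))

theorem contDiffAt_yHat {R r : ℝ} (hR : 0 < R) (hr : 0 < r) : ContDiffAt ℝ 1 (yHat R) r := by
  have h : ContDiffOn ℝ 1 (yHat R) (Ioi 0) := by
    rw [show (1 : WithTop ℕ∞) = 0 + 1 by simp, contDiffOn_succ_iff_deriv_of_isOpen isOpen_Ioi]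
    refine ⟨fun s hs => (hasDerivAt_yHat hR hs).differentiableAt.differentiableWithinAt,
      by simp, ?_⟩
    rw [contDiffOn_zero]
    exact ContinuousOn.congr (fun s hs => (continuousAt_yHat' hR hs).continuousWithinAt)
      fun s hs => (hasDerivAt_yHat hR hs).deriv
  exact h.contDiffAt (Ioi_mem_nhds hr)

/-! ### The measure `∇ū` -/

/-- The distributional gradient of `ū` is minus the unit normal times the arc length on the circle
`r = 3R/2`. -/
theorem integral_uBar_mul_divergence {R : ℝ} (hR : 0 < R)
    {v : EuclideanSpace ℝ (Fin 2) → EuclideanSpace ℝ (Fin 2)} (hv : IsTest 1 (annulus R) v) :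
    ∫ x in annulus R, uBar R x * divergence v x =
      ∫ θ in (0 : ℝ)..2 * Real.pi, 3 * R / 2 *
        inner ℝ (v (circlePoint (3 * R / 2) θ))
          (gradient radius (circlePoint (3 * R / 2) θ)) := by
  have hm := (isOpen_annulus R).measurableSet
  have hz : ∀ x ∉ annulus R, divergence v x = 0 := fun x hx =>
    divergence_eq_zero_of_notMem_tsupport fun h => hx (hv.tsupport_subset h)
  rw [← integral_ball_divergence hv.contDiff (by positivity : 0 < 3 * R / 2),
    setIntegral_congr_fun hm (g := (Metric.ball 0 (3 * R / 2)).indicator (divergence v)),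
    setIntegral_indicator Metric.isOpen_ball.measurableSet]
  · exact (setIntegral_eq_of_subset_of_forall_sdiff_eq_zero Metric.isOpen_ball.measurableSet
      inter_subset_right fun x hx => hz x fun h => hx.2 ⟨h, hx.1⟩).symm
  · intro x hx
    have h := mem_annulus.1 hx
    by_cases hb : ‖x‖ < 3 * R / 2
    · simp [uBar, radius, indicator, hb, h.1]
    · simp [uBar, radius, indicator, hb]

theorem integrableOn_uBar (R : ℝ) : IntegrableOn (uBar R) (annulus R) := by
  have hm : Measurable (uBar R) :=
    (measurable_one.indicator measurableSet_Ioo).comp (continuous_norm.measurable :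
      Measurable fun x : EuclideanSpace ℝ (Fin 2) => ‖x‖)
  refine IntegrableOn.of_bound (volume_annulus_ne_top R).lt_top hm.aestronglyMeasurable 1
    (ae_of_all _ fun x => ?_)
  unfold uBar indicator
  split_ifs <;> simp

theorem tvSeminorm_uBar_le {R : ℝ} (hR : 0 < R) :
    tvSeminorm (annulus R) (uBar R) ≤ ENNReal.ofReal (3 * Real.pi * R) := by
  refine iSup₂_le fun v hv => ENNReal.ofReal_le_ofReal ?_
  rw [integral_uBar_mul_divergence hR hv.1]
  have h : ∀ θ ∈ Icc (0 : ℝ) (2 * Real.pi), 3 * R / 2 * inner ℝ (v (circlePoint (3 * R / 2) θ))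
      (gradient radius (circlePoint (3 * R / 2) θ)) ≤ 3 * R / 2 := by
    intro θ _
    have h1 := real_inner_le_norm (v (circlePoint (3 * R / 2) θ))
      (gradient radius (circlePoint (3 * R / 2) θ))
    have h2 := mul_le_one₀ (hv.2 (circlePoint (3 * R / 2) θ)) (norm_nonneg _)
      (norm_gradient_radius_le (circlePoint (3 * R / 2) θ))
    nlinarith
  have hc : Continuous fun θ => 3 * R / 2 * inner ℝ (v (circlePoint (3 * R / 2) θ))
      (gradient radius (circlePoint (3 * R / 2) θ)) := by
    have h1 : Continuous fun θ => circlePoint (3 * R / 2) θ :=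
      continuous_circlePoint.comp (by fun_prop : Continuous fun θ : ℝ => (3 * R / 2, θ))
    have h2 := hv.1.contDiff.continuous
    simp only [gradient_radius, norm_circlePoint]
    fun_prop
  have := intervalIntegral.integral_mono_on (by positivity : (0 : ℝ) ≤ 2 * Real.pi)
    (hc.intervalIntegrable _ _) (intervalIntegrable_const (μ := volume)) h
  refine this.trans (le_of_eq ?_)
  rw [intervalIntegral.integral_const, smul_eq_mul]
  ring

theorem memBV_uBar {R : ℝ} (hR : 0 < R) : MemBV (annulus R) (uBar R) :=
  ⟨integrableOn_uBar R, (tvSeminorm_uBar_le hR).trans_lt ENNReal.ofReal_lt_top⟩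

/-! ### Approximation of the state, the adjoint state and the dual field -/

/-- Approximation of a smooth radial profile that vanishes at the two boundary radii. -/
theorem exists_radial_approx_of_smooth {R : ℝ} (hR : 0 < R) {f : ℝ → ℝ}
    (hf : ∀ r, 0 < r → ContDiffAt ℝ ∞ f r) (hfR : f R = 0) (hf2R : f (2 * R) = 0) :
    ∃ g : ℕ → ℝ → ℝ, (∀ n r, |g n r| ≤ |f r|) ∧
      (∀ r ∈ Ioo R (2 * R), Tendsto (fun n => g n r) atTop (𝓝 (f r))) ∧
      (∀ n, IsTest ∞ (annulus R) fun x => g n ‖x‖) ∧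
      (∀ n, IsTest ∞ (annulus R) fun x => g n ‖x‖ • gradient radius x) ∧
      BddTendsto (annulus R) (fun n x => g n ‖x‖) (fun x => f ‖x‖) ∧
      BddTendsto (annulus R) (fun n => gradient fun x => g n ‖x‖)
        (fun x => deriv f ‖x‖ • gradient radius x) ∧
      BddTendsto (annulus R) (fun n x => g n ‖x‖ • gradient radius x)
        (fun x => f ‖x‖ • gradient radius x) ∧
      BddTendsto (annulus R) (fun n => divergence fun x => g n ‖x‖ • gradient radius x)
        (fun x => deriv f ‖x‖ + f ‖x‖ / ‖x‖) := by
  have hpos : ∀ r ∈ Icc R (2 * R), 0 < r := fun r hr => hR.trans_le hr.1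
  obtain ⟨L, hL⟩ := isCompact_Icc.exists_bound_of_continuousOn (s := Icc R (2 * R)) (f := deriv f)
    fun r hr => (contDiffAt_deriv (hf r (hpos r hr))).continuousAt.continuousWithinAt
  exact exists_radial_approx hR (fun _ r hr => hf r (hR.trans hr.1))
    (fun _ r hr => ((hf r (hpos r hr)).differentiableAt (by simp)).hasDerivAt) (fun _ => hL)
    (fun _ => hfR) (fun _ => hf2R) (fun _ _ => tendsto_const_nhds) fun _ _ => tendsto_const_nhds

theorem isH10_yBar {R : ℝ} (hR : 0 < R) :
    IsH10 (annulus R) (yBar R) (fun x => yHat' R ‖x‖ • gradient radius x) := by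
  obtain ⟨K, hK0, hK⟩ := exists_mul_abs_deriv_smoothStep_le
  -- steps with index at least `4 / R` are equal to `1` at `r = R`, so that
  -- the boundary value `ŷ(R) = 0` is kept
  obtain ⟨m, hm⟩ := exists_nat_ge (4 / R)
  have hm' : 4 ≤ m * R := (div_le_iff₀ hR).1 hm
  -- the kink at `r = 3R/2` is smoothed by switching `yJump` off before it is reached
  set f : ℕ → ℝ → ℝ := fun n r => constC R * Real.log (r / (2 * R))
    + smoothStep (n + m) (3 * R / 2 - r) * yJump R r with hf
  set f' : ℕ → ℝ → ℝ := fun n r => constC R * r⁻¹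
    + (-deriv (smoothStep (n + m)) (3 * R / 2 - r) * yJump R r
      + smoothStep (n + m) (3 * R / 2 - r) * yJump' R r) with hf'
  have hlog : ∀ r, 0 < r → ContDiffAt ℝ ∞ (fun r => Real.log (r / (2 * R))) r := fun r hr =>
    (contDiffAt_id.div_const (2 * R)).log (by simp only [id]; positivity)
  have hd : ∀ n, ∀ r, 0 < r → HasDerivAt (f n) (f' n r) r := by
    intro n r hr
    refine ((hasDerivAt_log_div hR hr).const_mul _).add ?_
    have h1 := (hasDerivAt_smoothStep (n + m) (3 * R / 2 - r)).comp r
      ((hasDerivAt_id r).const_sub (3 * R / 2))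
    rw [mul_neg, mul_one] at h1
    exact h1.mul (hasDerivAt_yJump hR hr)
  have hs : ∀ r ∈ Ioo R (2 * R), Tendsto (fun n => f n r) atTop (𝓝 (yHat R r)) ∧
      Tendsto (fun n => f' n r) atTop (𝓝 (yHat' R r)) := by
    intro r hr
    rw [yHat_eq, yHat', div_eq_mul_inv (constC R)]
    by_cases h : r < 3 * R / 2
    · have h1 := (tendsto_add_atTop_nat m).eventually
        (eventually_smoothStep_eq_one (sub_pos.2 h))
      rw [if_pos h, if_pos h]
      constructor <;> refine tendsto_const_nhds.congr' ?_ <;>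
        filter_upwards [h1] with n hn <;> simp [hf, hf', hn.1, hn.2]
    · have h0 : 3 * R / 2 - r ≤ 0 := by linarith [not_lt.1 h]
      have h1 : ∀ n : ℕ, smoothStep (n + m) (3 * R / 2 - r) = 0 := fun n =>
        smoothStep_eq_zero ((mul_nonpos_of_nonneg_of_nonpos (by positivity) h0).trans zero_le_one)
      rw [if_neg h, if_neg h]
      constructor <;> refine tendsto_const_nhds.congr fun n => ?_ <;>
        simp [hf, hf', h1, deriv_smoothStep_eq_zero h0]
  have hbound : ∀ n, ∀ r ∈ Icc R (2 * R),
      |f' n r| ≤ |constC R| / R + (2 * K * R + 2 * R) := by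
    intro n r hr
    have hr0 : 0 < r := hR.trans_le hr.1
    refine (abs_add_le _ _).trans (add_le_add ?_ ((abs_add_le _ _).trans (add_le_add ?_ ?_)))
    · rw [abs_mul, abs_inv, abs_of_pos hr0, div_eq_mul_inv]
      have := hr.1
      gcongr
    · have h0 := abs_yJump_le hR hr
      rw [abs_mul, abs_neg]
      rcases le_total r (3 * R / 2) with h | h
      · have ht : 0 ≤ 3 * R / 2 - r := sub_nonneg.2 h
        have h2 := (hK (n + m) _ ht).2
        rw [abs_of_nonneg ht] at h0
        calc |deriv (smoothStep (n + m)) (3 * R / 2 - r)| * |yJump R r|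
            ≤ |deriv (smoothStep (n + m)) (3 * R / 2 - r)| * (2 * (3 * R / 2 - r) ^ 2) := by gcongr
          _ = 2 * ((3 * R / 2 - r) ^ 2 * |deriv (smoothStep (n + m)) (3 * R / 2 - r)|) := by ring
          _ ≤ 2 * (K * (3 * R / 2 - r)) := by gcongr
          _ ≤ 2 * K * R := by nlinarith [hr.1]
      · rw [deriv_smoothStep_eq_zero (by linarith), abs_zero, zero_mul]
        positivity
    · rw [abs_mul, abs_of_nonneg (smoothStep_nonneg _ _)]
      have h1 : |3 * R / 2 - r| ≤ R := abs_le.2 ⟨by linarith [hr.2], by linarith [hr.1]⟩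
      calc _ ≤ 1 * (2 * |3 * R / 2 - r|) := by
            gcongr
            · exact smoothStep_le_one _ _
            · exact abs_yJump'_le hR hr
        _ ≤ 2 * R := by linarith
  obtain ⟨g, -, -, ht, -, h1, h2, -, -⟩ := exists_radial_approx hR (f := f) (f' := f')
    (F := yHat R) (F' := yHat' R) (fun n r hr => by
      have hr0 : 0 < r := hR.trans hr.1
      refine (contDiffAt_const.mul (hlog r hr0)).add (ContDiffAt.mul ?_ ?_)
      · exact ((contDiff_smoothStep (n + m)).comp
          (by fun_prop : ContDiff ℝ ∞ fun r : ℝ => 3 * R / 2 - r)).contDiffAt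
      · exact (((by fun_prop : ContDiff ℝ ∞ fun r : ℝ => -(r ^ 2 / 4)).contDiffAt).add
          (contDiffAt_const.mul (hlog r hr0))).add contDiffAt_const)
    (fun n r hr => hd n r (hR.trans_le hr.1)) hbound
    (fun n => by
      have h := yHat_left hR
      rw [yHat_eq, if_pos (by linarith)] at h
      simp only [hf]
      rw [smoothStep_eq_one, one_mul, h]
      push_cast
      nlinarith [(Nat.cast_nonneg n : (0 : ℝ) ≤ n)])
    (fun n => by
      simp only [hf]
      rw [smoothStep_eq_zero, zero_mul, div_self (by positivity), Real.log_one, mul_zero, add_zero]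
      have : 3 * R / 2 - 2 * R ≤ 0 := by linarith
      exact (mul_nonpos_of_nonneg_of_nonpos (by positivity) this).trans zero_le_one)
    (fun r hr => (hs r hr).1) (fun r hr => (hs r hr).2)
  exact IsH10.of_bddTendsto (isOpen_annulus R).measurableSet (volume_annulus_ne_top R) ht h1 h2

/-! ### The weak solutions -/

theorem ne_zero_of_norm_mem_Icc {R : ℝ} (hR : 0 < R) {x : EuclideanSpace ℝ (Fin 2)}
    (hx : ‖x‖ ∈ Icc R (2 * R)) : x ≠ 0 :=
  ne_zero_of_norm_pos (hR.trans_le hx.1)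

theorem norm_mem_Icc {R : ℝ} {x : EuclideanSpace ℝ (Fin 2)} (hx : x ∈ annulus R) :
    ‖x‖ ∈ Icc R (2 * R) := Ioo_subset_Icc_self (mem_annulus.1 hx)

theorem memLp_radialField {R : ℝ} (hR : 0 < R) {k : ℝ → ℝ} (hk : ∀ r, 0 < r → ContinuousAt k r)
    (q : ℝ≥0∞) :
    MemLp (fun x => k ‖x‖ • gradient radius x) q (volume.restrict (annulus R)) :=
  memLp_annulus (fun x hx => by
    have h0 := ne_zero_of_norm_mem_Icc hR hx
    exact (ContinuousAt.comp (f := fun x : EuclideanSpace ℝ (Fin 2) => ‖x‖)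
      (hk _ (norm_pos_iff.2 h0)) continuous_norm.continuousAt).smul
      (contDiffAt_gradient_radius h0 (k := 0)).continuousAt) q

/-- Integration by parts against the smooth radial field `k(r) ∇r`. -/
theorem integral_inner_radialField {R : ℝ} (hR : 0 < R) {k : ℝ → ℝ}
    (hk : ∀ r, 0 < r → ContDiffAt ℝ ∞ k r) {φ : EuclideanSpace ℝ (Fin 2) → ℝ}
    (hφ : IsTest ∞ (annulus R) φ) :
    ∫ x in annulus R, inner ℝ (k ‖x‖ • gradient radius x) (gradient φ x)
      = -∫ x in annulus R, φ x * (deriv k ‖x‖ + k ‖x‖ / ‖x‖) := by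
  have h0 : ∀ x ∈ annulus R, x ≠ 0 := fun x hx => ne_zero_of_norm_mem_Icc hR (norm_mem_Icc hx)
  have hdiv : ∀ x ∈ annulus R, divergence (fun x => k ‖x‖ • gradient radius x) x
      = deriv k ‖x‖ + k ‖x‖ / ‖x‖ := fun x hx =>
    divergence_radial (h0 x hx)
      ((hk _ (norm_pos_iff.2 (h0 x hx))).differentiableAt (by simp)).hasDerivAt
  have hm := (isOpen_annulus R).measurableSet
  have h2 : MemLp (fun x : EuclideanSpace ℝ (Fin 2) => deriv k ‖x‖ + k ‖x‖ / ‖x‖) 2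
      (volume.restrict (annulus R)) := memLp_annulus (fun x hx => by
    have h0 := norm_pos_iff.2 (ne_zero_of_norm_mem_Icc hR hx)
    exact ContinuousAt.comp (f := fun x : EuclideanSpace ℝ (Fin 2) => ‖x‖)
      (g := fun r => deriv k r + k r / r)
      ((contDiffAt_deriv (hk _ h0)).continuousAt.add
        ((hk _ h0).continuousAt.div continuousAt_id h0.ne')) continuous_norm.continuousAt) 2
  have h := integral_inner_gradient_test (isOpen_annulus R) hφ
    (G := fun x => k ‖x‖ • gradient radius x) (fun x hx =>
      ((contDiffAt_infty.1 (hk _ (norm_pos_iff.2 (h0 x hx))) 1).comp x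
        (contDiffAt_norm ℝ (h0 x hx))).smul (contDiffAt_gradient_radius (h0 x hx)))
    (memLp_radialField hR (fun r hr => (hk r hr).continuousAt) 2)
    ((memLp_congr_ae (ae_restrict_of_forall_mem hm hdiv)).2 h2)
  have e : ∫ x in annulus R, φ x * divergence (fun x => k ‖x‖ • gradient radius x) x
      = ∫ x in annulus R, φ x * (deriv k ‖x‖ + k ‖x‖ / ‖x‖) :=
    setIntegral_congr_fun hm fun x hx => by simp only [hdiv x hx]
  rw [← e, ← h]
  congr 1
  funext x
  exact real_inner_comm _ _

/-- The weak form of `-Δ ȳ = ū`. The gradient of `ȳ` is that of `C ln r`, which is harmonic, plus that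
of `yJump`, restricted to `r < 3R/2`. -/
theorem integral_inner_gradient_yBar {R : ℝ} (hR : 0 < R) {φ : EuclideanSpace ℝ (Fin 2) → ℝ}
    (hφ : IsTest ∞ (annulus R) φ) :
    ∫ x in annulus R, inner ℝ (yHat' R ‖x‖ • gradient radius x) (gradient φ x)
      = ∫ x in annulus R, uBar R x * φ x := by
  have hm := (isOpen_annulus R).measurableSet
  have h0 : ∀ x ∈ annulus R, x ≠ 0 := fun x hx => ne_zero_of_norm_mem_Icc hR (norm_mem_Icc hx)
  have hj : ∀ r, 0 < r → ContDiffAt ℝ ∞ (yJump' R) r := fun r hr =>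
    (contDiffAt_id.div_const 2).neg.add (contDiffAt_const.div contDiffAt_id hr.ne')
  -- the logarithm is harmonic
  have h1 : ∫ x in annulus R, inner ℝ ((constC R / ‖x‖) • gradient radius x) (gradient φ x) = 0 := by
    rw [integral_inner_radialField hR (k := fun r => constC R / r)
      (fun r hr => contDiffAt_const.div contDiffAt_id hr.ne') hφ, neg_eq_zero]
    refine integral_eq_zero_of_ae (ae_restrict_of_forall_mem hm fun x hx => ?_)
    have hn := norm_ne_zero_iff.2 (h0 x hx)
    have hd := ((hasDerivAt_inv hn).const_mul (constC R)).deriv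
    simp only [div_eq_mul_inv, hd, Pi.zero_apply]
    field_simp
    ring
  -- the divergence theorem for `φ` times the gradient of `yJump`; the boundary integral over the
  -- circle `r = 3R/2` vanishes together with `yJump'`
  have ht : IsTest 1 (annulus R) (fun x => φ x • (yJump' R ‖x‖ • gradient radius x)) :=
    hφ.smul_contDiffOn fun x hx =>
      ((contDiffAt_infty.1 (hj _ (norm_pos_iff.2 (h0 x hx))) 1).comp x
        (contDiffAt_norm ℝ (h0 x hx))).smul (contDiffAt_gradient_radius (h0 x hx))
  have h2 := integral_uBar_mul_divergence hR ht
  have h3 : ∀ θ : ℝ, 3 * R / 2 * inner ℝ (φ (circlePoint (3 * R / 2) θ) •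
      (yJump' R ‖circlePoint (3 * R / 2) θ‖ • gradient radius (circlePoint (3 * R / 2) θ)))
      (gradient radius (circlePoint (3 * R / 2) θ)) = 0 := by
    intro θ
    rw [norm_circlePoint, abs_of_pos (by positivity), yJump'_eq (by positivity)]
    simp
  simp only [h3, intervalIntegral.integral_zero] at h2
  have hdiv : ∀ x ∈ annulus R,
      uBar R x * divergence (fun x => φ x • (yJump' R ‖x‖ • gradient radius x)) x
      = inner ℝ ((yHat' R ‖x‖ - constC R / ‖x‖) • gradient radius x) (gradient φ x)
        - uBar R x * φ x := by
    intro x hx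
    have hn := norm_pos_iff.2 (h0 x hx)
    have hk : HasDerivAt (yJump' R) (-(1 / 2) + 9 * R ^ 2 / 8 * -(‖x‖ ^ 2)⁻¹) ‖x‖ :=
      ((hasDerivAt_id ‖x‖).div_const 2).neg.add ((hasDerivAt_inv hn.ne').const_mul _)
    have hd : DifferentiableAt ℝ (fun x => yJump' R ‖x‖ • gradient radius x) x :=
      ((hk.comp_hasFDerivAt x ((contDiffAt_norm (n := 1) ℝ (h0 x hx)).differentiableAt
        (by simp)).hasFDerivAt).differentiableAt).smul
        ((contDiffAt_gradient_radius (h0 x hx) (k := 1)).differentiableAt (by simp))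
    rw [divergence_smul (hφ.contDiff.differentiable (by simp) x) hd,
      divergence_radial (h0 x hx) hk]
    -- `-Δ yJump = 1`
    have e1 : -(1 / 2) + 9 * R ^ 2 / 8 * -(‖x‖ ^ 2)⁻¹ + yJump' R ‖x‖ / ‖x‖ = -1 := by
      unfold yJump'
      field_simp
      ring
    have hR' := (mem_annulus.1 hx).1
    rw [e1, yHat', add_sub_cancel_left, real_inner_comm (gradient φ x)]
    by_cases h : ‖x‖ < 3 * R / 2
    · simp [uBar, radius, indicator, h, hR']
      ring
    · simp [uBar, radius, indicator, h]
  rw [setIntegral_congr_fun hm hdiv] at h2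
  have hg2 := (hφ.mono_order (l := 1) (by simp)).memLp_gradient 2 (volume.restrict (annulus R))
  have hc : ∀ r, 0 < r → ContinuousAt (fun r => constC R / r) r := fun r hr =>
    continuousAt_const.div continuousAt_id hr.ne'
  have hm1 := memLp_radialField hR hc 2
  have hm2 := memLp_radialField hR (k := fun r => yHat' R r - constC R / r)
    (fun r hr => (continuousAt_yHat' hR hr).sub (hc r hr)) 2
  rw [integral_sub (integrable_inner_of_memLp hm2 hg2)
    (integrable_mul_isTest (integrableOn_uBar R) hφ), sub_eq_zero] at h2
  rw [← h2, ← add_zero (∫ x in annulus R, inner ℝ ((yHat' R ‖x‖ - _) • _) _), ← h1,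
    ← integral_add (integrable_inner_of_memLp hm2 hg2) (integrable_inner_of_memLp hm1 hg2)]
  congr 1
  funext x
  rw [← inner_add_left, ← add_smul, sub_add_cancel]

theorem isWeakSolution_yBar {R : ℝ} (hR : 0 < R) :
    IsWeakSolution (annulus R) (uBar R) (yBar R) :=
  ⟨integrableOn_uBar R, _, isH10_yBar hR, fun _ hφ => integral_inner_gradient_yBar hR hφ⟩

theorem admissible_bar {R : ℝ} (hR : 0 < R) : Admissible (annulus R) (yBar R) (uBar R) :=
  ⟨memBV_uBar hR, isWeakSolution_yBar hR⟩

theorem continuousAt_lapHat {R : ℝ} (β : ℝ) {r : ℝ} (hr : 0 < r) :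
    ContinuousAt (lapHat R β) r := by
  have h := contDiffAt_pHat R β hr
  exact (contDiffAt_deriv (contDiffAt_deriv h)).continuousAt.add
    ((contDiffAt_deriv h).continuousAt.div continuousAt_id hr.ne')

theorem yDesired_eq {R β : ℝ} {x : EuclideanSpace ℝ (Fin 2)} (hx : x ≠ 0) :
    yDesired R β x = lapHat R β ‖x‖ + yHat R ‖x‖ := by
  rw [yDesired, laplacian_pBar hx]; rfl

theorem memLp_yDesired {R : ℝ} (hR : 0 < R) (β : ℝ) :
    MemLp (yDesired R β) 2 (volume.restrict (annulus R)) := by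
  have hm := (isOpen_annulus R).measurableSet
  refine (memLp_congr_ae (ae_restrict_of_forall_mem hm fun x hx =>
    yDesired_eq (ne_zero_of_norm_mem_Icc hR (norm_mem_Icc hx)))).2 (memLp_annulus (fun x hx => ?_) 2)
  have h0 := norm_pos_iff.2 (ne_zero_of_norm_mem_Icc hR hx)
  exact ContinuousAt.comp (f := fun x : EuclideanSpace ℝ (Fin 2) => ‖x‖)
    (g := fun r => lapHat R β r + yHat R r)
    ((continuousAt_lapHat β h0).add (hasDerivAt_yHat hR h0).continuousAt)
    continuous_norm.continuousAt

theorem isH10_pBar {R : ℝ} (hR : 0 < R) (β : ℝ) :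
    IsH10 (annulus R) (pBar R β) (fun x => deriv (pHat R β) ‖x‖ • gradient radius x) := by
  obtain ⟨g, -, -, ht, -, h1, h2, -, -⟩ := exists_radial_approx_of_smooth hR
    (fun r hr => contDiffAt_pHat R β hr) (pHat_left hR β) (pHat_right hR β)
  exact IsH10.of_bddTendsto (isOpen_annulus R).measurableSet (volume_annulus_ne_top R) ht
    (h1.congr_right fun x hx => (pBar_eq (ne_zero_of_norm_mem_Icc hR (norm_mem_Icc hx))).symm) h2

theorem isWeakSolution_pBar {R : ℝ} (hR : 0 < R) (β : ℝ) :
    IsWeakSolution (annulus R) (fun x => yBar R x - yDesired R β x) (pBar R β) := by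
  have hfin : IsFiniteMeasure (volume.restrict (annulus R)) :=
    ⟨by simpa using (volume_annulus_ne_top R).lt_top⟩
  refine ⟨((isH10_yBar hR).memLp.sub (memLp_yDesired hR β)).integrable one_le_two, _,
    isH10_pBar hR β, fun φ hφ => ?_⟩
  rw [integral_inner_radialField hR (fun r hr => contDiffAt_deriv (contDiffAt_pHat R β hr)) hφ,
    ← integral_neg]
  refine setIntegral_congr_fun (isOpen_annulus R).measurableSet fun x hx => ?_
  simp only [yDesired_eq (ne_zero_of_norm_mem_Icc hR (norm_mem_Icc hx)), lapHat, yBar, radius]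
  ring

/-! ### Optimality -/

/-- The field `h̄` is the limit of admissible test fields, and attains the total variation of
`ū`. -/
theorem integral_uBar_mul_pBar {R β : ℝ} (hR : 0 < R) (hβ : 0 < β) :
    tvSeminorm (annulus R) (uBar R) = ENNReal.ofReal (3 * Real.pi * R) ∧
    ∫ x in annulus R, uBar R x * pBar R β x = -(β * (3 * Real.pi * R)) := by
  obtain ⟨g, hg, hlim, -, ht, -, -, -, h1⟩ := exists_radial_approx_of_smooth hR
    (fun r _ => (contDiff_hHat R β).contDiffAt) (hHat_left hR β) (hHat_right hR β)
  have ht' := fun n => (ht n).mono_order (l := 1) (by simp)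
  have hm := (isOpen_annulus R).measurableSet
  have hv : ∀ n x, ‖g n ‖x‖ • gradient radius x‖ ≤ β := fun n x => by
    rw [norm_smul]
    exact (mul_le_mul ((hg n _).trans (abs_hHat_le R hβ _)) (norm_gradient_radius_le x)
      (norm_nonneg _) hβ.le).trans (mul_one β).le
  have h2 := (h1.integral_mul hm (integrableOn_uBar R)
    fun n => continuous_divergence (ht' n).contDiff).2
  have h3 : ∀ n, ∫ x in annulus R, uBar R x * divergence (fun x => g n ‖x‖ • gradient radius x) x
      = 3 * Real.pi * R * g n (3 * R / 2) := by
    intro n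
    rw [integral_uBar_mul_divergence hR (ht' n)]
    have : ∀ θ : ℝ, 3 * R / 2 * inner ℝ (g n ‖circlePoint (3 * R / 2) θ‖ •
        gradient radius (circlePoint (3 * R / 2) θ)) (gradient radius (circlePoint (3 * R / 2) θ))
        = 3 * R / 2 * g n (3 * R / 2) := by
      intro θ
      have hn : ‖circlePoint (3 * R / 2) θ‖ = 3 * R / 2 := by
        rw [norm_circlePoint, abs_of_pos (by positivity)]
      rw [inner_smul_left, real_inner_self_eq_norm_sq, norm_gradient_radius
        (ne_zero_of_norm_pos (by rw [hn]; positivity)), hn]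
      simp
    simp only [this, intervalIntegral.integral_const, smul_eq_mul]
    ring
  have h4 : Tendsto (fun n => 3 * Real.pi * R * g n (3 * R / 2)) atTop
      (𝓝 (3 * Real.pi * R * -β)) := by
    rw [← hHat_mid hR β]
    exact (hlim _ ⟨by linarith, by linarith⟩).const_mul _
  have h5 : ∀ n, -(β * (tvSeminorm (annulus R) (uBar R)).toReal)
      ≤ 3 * Real.pi * R * g n (3 * R / 2) := fun n =>
    (integral_mul_divergence_le (memBV_uBar hR) hβ (ht' n) (hv n)).trans (h3 n).le
  have h6 := ge_of_tendsto' h4 h5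
  constructor
  · refine le_antisymm (tvSeminorm_uBar_le hR) (ENNReal.ofReal_le_of_le_toReal ?_)
    have : β * (3 * Real.pi * R) ≤ β * (tvSeminorm (annulus R) (uBar R)).toReal := by linarith
    exact le_of_mul_le_mul_left this hβ
  · have h7 := tendsto_nhds_unique (h2.congr h3) h4
    rw [show -(β * (3 * Real.pi * R)) = 3 * Real.pi * R * -β by ring, ← h7]
    refine setIntegral_congr_fun hm fun x hx => ?_
    simp only [pBar_eq (ne_zero_of_norm_mem_Icc hR (norm_mem_Icc hx)), pHat]
    ring

theorem isOptimal_bar {R β : ℝ} (hR : 0 < R) (hβ : 0 < β) :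
    IsOptimal (annulus R) (yDesired R β) β (yBar R) (uBar R) ∧
      ∀ y u : EuclideanSpace ℝ (Fin 2) → ℝ, IsOptimal (annulus R) (yDesired R β) β y u →
        y =ᵐ[volume.restrict (annulus R)] yBar R ∧
        u =ᵐ[volume.restrict (annulus R)] uBar R := by
  have h0 : ∀ x ∈ annulus R, x ≠ 0 := fun x hx => ne_zero_of_norm_mem_Icc hR (norm_mem_Icc hx)
  obtain ⟨φ, -, -, hφ, -, hφp, hφG, -, -⟩ := exists_radial_approx_of_smooth hR
    (fun r hr => contDiffAt_pHat R β hr) (pHat_left hR β) (pHat_right hR β)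
  obtain ⟨g, hg, -, -, ht, -, -, -, hgp⟩ := exists_radial_approx_of_smooth hR
    (fun r _ => (contDiff_hHat R β).contDiffAt) (hHat_left hR β) (hHat_right hR β)
  have htv := integral_uBar_mul_pBar hR hβ
  refine isOptimal_and_unique (isOpen_annulus R) (admissible_bar hR) fun y u h =>
    objective_add_le (isOpen_annulus R) (volume_annulus_ne_top R) hβ (admissible_bar hR)
      (memLp_yDesired hR β) hφ (hφp.congr_right fun x hx => (pBar_eq (h0 x hx)).symm) hφG
      (fun x hx => ?_) (fun x hx => ?_) (fun n => (ht n).mono_order (by simp)) (fun n x => ?_)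
      (hgp.congr_right fun x hx => ?_) ?_ h
  · have hn := norm_pos_iff.2 (h0 x hx)
    exact ((contDiffAt_infty.1 (contDiffAt_deriv (contDiffAt_pHat R β hn)) 1).comp x
      (contDiffAt_norm ℝ (h0 x hx))).smul (contDiffAt_gradient_radius (h0 x hx))
  · have hn := norm_pos_iff.2 (h0 x hx)
    rw [divergence_radial (h0 x hx)
      ((contDiffAt_deriv (contDiffAt_pHat R β hn)).differentiableAt (by simp)).hasDerivAt,
      yDesired_eq (h0 x hx), lapHat, yBar, radius]
    ring
  · rw [norm_smul]
    exact (mul_le_mul ((hg n _).trans (abs_hHat_le R hβ _)) (norm_gradient_radius_le x)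
      (norm_nonneg _) hβ.le).trans (mul_one β).le
  · rw [pBar_eq (h0 x hx), pHat]
    ring
  · rw [htv.2, htv.1, ENNReal.toReal_ofReal (by positivity)]

theorem isW0Div_hBar {R : ℝ} (hR : 0 < R) (β : ℝ) {q : ℝ≥0∞} (hq : 1 ≤ q) (hq' : q < ⊤) :
    IsW0Div q (annulus R) (hBar R β) (pBar R β) := by
  obtain ⟨g, -, -, -, ht, -, -, h1, h2⟩ := exists_radial_approx_of_smooth hR
    (fun r _ => (contDiff_hHat R β).contDiffAt) (hHat_left hR β) (hHat_right hR β)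
  have hm := (isOpen_annulus R).measurableSet
  have h3 := h1.eLpNorm hm (volume_annulus_ne_top R) (fun n => (ht n).contDiff.continuous) hq hq'.ne
  have h4 := (h2.congr_right (g := pBar R β) fun x hx => by
    rw [pBar_eq (ne_zero_of_norm_mem_Icc hR (norm_mem_Icc hx)), pHat]; ring).eLpNorm hm
    (volume_annulus_ne_top R)
    (fun n => continuous_divergence ((ht n).contDiff.of_le (by simp))) hq hq'.ne
  exact ⟨h3.1, h4.1, _, ht, h3.2, h4.2⟩

/-! ### The cosine integral -/

/-- The beginning of the asymptotic expansion of `Ci` at infinity. -/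
noncomputable def ciApprox (t : ℝ) : ℝ :=
  Real.sin t * (t⁻¹ - 2 * t⁻¹ ^ 3) + Real.cos t * (-t⁻¹ ^ 2 + 6 * t⁻¹ ^ 4)

theorem hasDerivAt_ciApprox {t : ℝ} (ht : t ≠ 0) :
    HasDerivAt ciApprox (Real.cos t / t - 24 * (Real.cos t * t⁻¹ ^ 5)) t := by
  have hi := hasDerivAt_inv ht
  have h := ((Real.hasDerivAt_sin t).mul (hi.sub ((hi.pow 3).const_mul 2))).add
    ((Real.hasDerivAt_cos t).mul ((hi.pow 2).neg.add ((hi.pow 4).const_mul 6)))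
  convert! h using 1
  simp
  ring

theorem tendsto_ciApprox : Tendsto ciApprox atTop (𝓝 0) := by
  have hi : Tendsto (fun t : ℝ => t⁻¹) atTop (𝓝 0) := tendsto_inv_atTop_zero
  have h1 : Tendsto (fun t : ℝ => t⁻¹ - 2 * t⁻¹ ^ 3) atTop (𝓝 0) := by
    simpa using hi.sub ((hi.pow 3).const_mul 2)
  have h2 : Tendsto (fun t : ℝ => -t⁻¹ ^ 2 + 6 * t⁻¹ ^ 4) atTop (𝓝 0) := by
    simpa using (hi.pow 2).neg.add ((hi.pow 4).const_mul 6)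
  have h := (h1.norm).add (h2.norm)
  rw [norm_zero, add_zero] at h
  refine squeeze_zero_norm (fun t => ?_) h
  refine (norm_add_le _ _).trans (add_le_add ?_ ?_) <;> rw [norm_mul]
  · exact mul_le_of_le_one_left (norm_nonneg _) (Real.abs_sin_le_one t)
  · exact mul_le_of_le_one_left (norm_nonneg _) (Real.abs_cos_le_one t)

theorem inv_pow_five_eq_rpow {t : ℝ} (ht : 0 < t) : t⁻¹ ^ 5 = t ^ (-5 : ℝ) := by
  rw [Real.rpow_neg ht.le, inv_pow]
  norm_cast

theorem integrableOn_inv_pow_five {t : ℝ} (ht : 0 < t) :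
    IntegrableOn (fun τ : ℝ => τ⁻¹ ^ 5) (Ioi t) :=
  (integrableOn_Ioi_rpow_of_lt (by norm_num : (-5 : ℝ) < -1) ht).congr_fun
    (fun τ hτ => (inv_pow_five_eq_rpow (ht.trans hτ)).symm) measurableSet_Ioi

theorem integral_inv_pow_five {t : ℝ} (ht : 0 < t) :
    ∫ τ in Ioi t, τ⁻¹ ^ 5 = t⁻¹ ^ 4 / 4 := by
  rw [setIntegral_congr_fun measurableSet_Ioi
    (fun τ hτ => inv_pow_five_eq_rpow (ht.trans hτ)),
    integral_Ioi_rpow_of_lt (by norm_num) ht]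
  rw [show (-5 : ℝ) + 1 = -((4 : ℕ) : ℝ) by norm_num, Real.rpow_neg ht.le, Real.rpow_natCast]
  push_cast
  ring

theorem integrableOn_cos_mul_inv_pow_five {t : ℝ} (ht : 0 < t) :
    IntegrableOn (fun τ : ℝ => Real.cos τ * τ⁻¹ ^ 5) (Ioi t) :=
  (integrableOn_inv_pow_five ht).bdd_mul (c := 1) Real.continuous_cos.aestronglyMeasurable
    (ae_of_all _ fun x => Real.abs_cos_le_one x)

theorem continuousOn_cos_div {t T : ℝ} (ht : 0 < t) (hT : 0 < T) :
    ContinuousOn (fun τ : ℝ => Real.cos τ / τ) (uIcc t T) :=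
  Real.continuous_cos.continuousOn.div continuousOn_id fun _ hτ =>
    ((lt_min ht hT).trans_le hτ.1).ne'

/-- Integration of `cos τ / τ` by parts, four times. -/
theorem integral_cos_div {t T : ℝ} (ht : 0 < t) (hT : 0 < T) :
    ∫ τ in t..T, Real.cos τ / τ
      = ciApprox T - ciApprox t + 24 * ∫ τ in t..T, Real.cos τ * τ⁻¹ ^ 5 := by
  have hpos : ∀ τ ∈ uIcc t T, τ ≠ 0 := fun τ hτ => ((lt_min ht hT).trans_le hτ.1).ne'
  have i1 := (continuousOn_cos_div ht hT).intervalIntegrable (μ := volume)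
  have i2 : IntervalIntegrable (fun τ : ℝ => Real.cos τ * τ⁻¹ ^ 5) volume t T :=
    (Real.continuous_cos.continuousOn.mul ((continuousOn_inv₀.mono fun τ hτ =>
      hpos τ hτ).pow 5)).intervalIntegrable
  have h := intervalIntegral.integral_eq_sub_of_hasDerivAt
    (fun τ hτ => hasDerivAt_ciApprox (hpos τ hτ)) (i1.sub (i2.const_mul 24))
  rw [intervalIntegral.integral_sub i1 (i2.const_mul 24), intervalIntegral.integral_const_mul] at h
  linarith

theorem tendsto_integral_cos_div {t : ℝ} (ht : 0 < t) :
    Tendsto (fun T => ∫ τ in t..T, Real.cos τ / τ) atTop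
      (𝓝 (-ciApprox t + 24 * ∫ τ in Ioi t, Real.cos τ * τ⁻¹ ^ 5)) := by
  have h := (tendsto_ciApprox.sub_const (ciApprox t)).add
    ((intervalIntegral_tendsto_integral_Ioi t (integrableOn_cos_mul_inv_pow_five ht)
      tendsto_id).const_mul 24)
  rw [zero_sub] at h
  refine h.congr' ?_
  filter_upwards [eventually_gt_atTop 0] with T hT
  exact (integral_cos_div ht hT).symm

theorem Ci_eq {t : ℝ} (ht : 0 < t) :
    Ci t = ciApprox t - 24 * ∫ τ in Ioi t, Real.cos τ * τ⁻¹ ^ 5 := by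
  rw [Ci, (tendsto_integral_cos_div ht).limUnder_eq]
  ring

theorem tendsto_Ci {t : ℝ} (ht : 0 < t) :
    Tendsto (fun T => -∫ τ in t..T, Real.cos τ / τ) atTop (𝓝 (Ci t)) := by
  have h := (tendsto_integral_cos_div ht).neg
  rwa [show -(-ciApprox t + 24 * ∫ τ in Ioi t, Real.cos τ * τ⁻¹ ^ 5) = Ci t by
    rw [Ci_eq ht]; ring] at h

theorem integral_cos_div_eq_Ci_sub {t T : ℝ} (ht : 0 < t) (hT : 0 < T) :
    ∫ τ in t..T, Real.cos τ / τ = Ci T - Ci t := by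
  have h1 := (tendsto_integral_cos_div ht)
  have h2 := (tendsto_integral_cos_div hT).const_add (∫ τ in t..T, Real.cos τ / τ)
  have h3 := tendsto_nhds_unique h1 (h2.congr' (by
    filter_upwards [eventually_gt_atTop 0] with S hS
    exact intervalIntegral.integral_add_adjacent_intervals
      (continuousOn_cos_div ht hT).intervalIntegrable
      (continuousOn_cos_div hT hS).intervalIntegrable))
  rw [Ci_eq ht, Ci_eq hT]
  linarith

theorem abs_Ci_sub_le {t : ℝ} (ht : 0 < t) : |Ci t - ciApprox t| ≤ 6 * t⁻¹ ^ 4 := by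
  rw [Ci_eq ht, sub_sub_cancel_left, abs_neg, abs_mul, abs_of_pos (by norm_num : (0 : ℝ) < 24)]
  have h : |∫ τ in Ioi t, Real.cos τ * τ⁻¹ ^ 5| ≤ ∫ τ in Ioi t, τ⁻¹ ^ 5 := by
    rw [← Real.norm_eq_abs]
    refine norm_integral_le_of_norm_le (integrableOn_inv_pow_five ht)
      (ae_restrict_of_forall_mem measurableSet_Ioi fun τ hτ => ?_)
    have hτ0 : 0 ≤ τ⁻¹ ^ 5 := pow_nonneg (inv_nonneg.2 (ht.trans hτ).le) 5
    rw [norm_mul, Real.norm_of_nonneg hτ0]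
    exact mul_le_of_le_one_left hτ0 (Real.abs_cos_le_one τ)
  rw [integral_inv_pow_five ht] at h
  linarith

/-- `Ci(4π) - Ci(2π)`, from the Taylor expansion of `1 / r` at `r = 3π`, the centre of the interval
of integration. -/
theorem abs_Ci_four_pi_sub_le :
    |(Ci (4 * Real.pi) - Ci (2 * Real.pi))
      - (44 / 243 * Real.pi⁻¹ ^ 2 - 16 / 81 * Real.pi⁻¹ ^ 4)| ≤ 1 / 5103 := by
  have hπ := Real.pi_pos
  set a : ℝ := (3 * Real.pi)⁻¹ with ha
  have haπ : 3 * Real.pi * a = 1 := mul_inv_cancel₀ (by positivity)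
  set q : ℝ → ℝ := fun s => a - a ^ 2 * s + a ^ 3 * s ^ 2 - a ^ 4 * s ^ 3 + a ^ 5 * s ^ 4
    - a ^ 6 * s ^ 5 with hq
  rw [← integral_cos_div_eq_Ci_sub (by positivity : 0 < 2 * Real.pi)
    (by positivity : 0 < 4 * Real.pi)]
  have hshift : ∫ τ in 2 * Real.pi..4 * Real.pi, Real.cos τ / τ
      = ∫ s in -Real.pi..Real.pi, -(Real.cos s / (s + 3 * Real.pi)) := by
    have h := intervalIntegral.integral_comp_add_right (a := -Real.pi) (b := Real.pi)
      (fun τ => Real.cos τ / τ) (3 * Real.pi)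
    rw [show -Real.pi + 3 * Real.pi = 2 * Real.pi by ring,
      show Real.pi + 3 * Real.pi = 4 * Real.pi by ring] at h
    rw [← h]
    congr 1
    funext s
    rw [show s + 3 * Real.pi = s + Real.pi + 2 * Real.pi by ring, Real.cos_add_two_pi,
      Real.cos_add_pi, neg_div]
  have hpoly : ∫ s in -Real.pi..Real.pi, -(Real.cos s * q s)
      = 44 / 243 * Real.pi⁻¹ ^ 2 - 16 / 81 * Real.pi⁻¹ ^ 4 := by
    have hd : ∀ s, HasDerivAt (fun s => -(Real.sin s * (a - a ^ 2 * s + a ^ 3 * s ^ 2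
        - a ^ 4 * s ^ 3 + a ^ 5 * s ^ 4 - a ^ 6 * s ^ 5 - (2 * a ^ 3 - 6 * a ^ 4 * s
        + 12 * a ^ 5 * s ^ 2 - 20 * a ^ 6 * s ^ 3) + (24 * a ^ 5 - 120 * a ^ 6 * s))
        + Real.cos s * (-a ^ 2 + 2 * a ^ 3 * s - 3 * a ^ 4 * s ^ 2 + 4 * a ^ 5 * s ^ 3
        - 5 * a ^ 6 * s ^ 4 - (-(6 * a ^ 4) + 24 * a ^ 5 * s - 60 * a ^ 6 * s ^ 2)
        - 120 * a ^ 6)))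
        (-(Real.cos s * q s)) s := by
      intro s
      have hp : ∀ (k : ℕ) (c : ℝ), HasDerivAt (fun s : ℝ => c * s ^ k) (c * (k * s ^ (k - 1))) s :=
        fun k c => (hasDerivAt_pow k s).const_mul c
      have h1 : ∀ c : ℝ, HasDerivAt (fun s : ℝ => c * s) c s := fun c => by
        simpa using (hasDerivAt_id s).const_mul c
      have h := ((Real.hasDerivAt_sin s).mul ((((((((h1 (a ^ 2)).const_sub a).add (hp 2 (a ^ 3))).sub
        (hp 3 (a ^ 4))).add (hp 4 (a ^ 5))).sub (hp 5 (a ^ 6))).sub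
        ((((h1 (6 * a ^ 4)).const_sub (2 * a ^ 3)).add (hp 2 (12 * a ^ 5))).sub
        (hp 3 (20 * a ^ 6)))).add ((h1 (120 * a ^ 6)).const_sub (24 * a ^ 5)))).add
        ((Real.hasDerivAt_cos s).mul (((((((h1 (2 * a ^ 3)).const_add (-a ^ 2)).sub
        (hp 2 (3 * a ^ 4))).add (hp 3 (4 * a ^ 5))).sub (hp 4 (5 * a ^ 6))).sub
        (((h1 (24 * a ^ 5)).const_add (-(6 * a ^ 4))).sub (hp 2 (60 * a ^ 6)))).sub_const
        (120 * a ^ 6)))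
      convert! h.neg using 1
      simp [hq]
      ring
    rw [intervalIntegral.integral_eq_sub_of_hasDerivAt (fun s _ => hd s)
      (Continuous.intervalIntegrable (by simp only [hq]; fun_prop) _ _)]
    simp only [Real.sin_pi, Real.cos_pi, Real.sin_neg, Real.cos_neg]
    rw [ha]
    field_simp
    ring
  have i1 : IntervalIntegrable (fun s => -(Real.cos s / (s + 3 * Real.pi))) volume
      (-Real.pi) Real.pi := by
    refine ContinuousOn.intervalIntegrable ?_
    rw [uIcc_of_le (by linarith)]
    exact (Real.continuous_cos.continuousOn.div (by fun_prop) fun s hs => by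
      linarith [hs.1]).neg
  have i2 : IntervalIntegrable (fun s => -(Real.cos s * q s)) volume (-Real.pi) Real.pi :=
    Continuous.intervalIntegrable (by simp only [hq]; fun_prop) _ _
  rw [hshift, ← hpoly, ← intervalIntegral.integral_sub i1 i2]
  -- `q` is a truncated geometric series for `1 / (s + 3π)`, with remainder `a⁶ s⁶ / (s + 3π)`
  have hb : ∀ s ∈ Ioc (-Real.pi) Real.pi,
      ‖-(Real.cos s / (s + 3 * Real.pi)) - -(Real.cos s * q s)‖ ≤ a ^ 6 * (2 * Real.pi)⁻¹ * s ^ 6 := by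
    intro s hs
    have hs0 : 2 * Real.pi ≤ s + 3 * Real.pi := by linarith [hs.1]
    have hne : s + 3 * Real.pi ≠ 0 := by linarith
    have e : -(Real.cos s / (s + 3 * Real.pi)) - -(Real.cos s * q s)
        = -(Real.cos s * (a ^ 6 * s ^ 6 * (s + 3 * Real.pi)⁻¹)) := by
      simp only [hq, ha]
      field_simp
      ring
    have hnn : 0 ≤ a ^ 6 * s ^ 6 * (s + 3 * Real.pi)⁻¹ :=
      mul_nonneg (by positivity) (inv_nonneg.2 (by linarith))
    rw [e, norm_neg, norm_mul, Real.norm_of_nonneg hnn]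
    calc ‖Real.cos s‖ * (a ^ 6 * s ^ 6 * (s + 3 * Real.pi)⁻¹)
        ≤ 1 * (a ^ 6 * s ^ 6 * (2 * Real.pi)⁻¹) := by
          refine mul_le_mul (Real.abs_cos_le_one s) ?_ hnn zero_le_one
          gcongr
      _ = a ^ 6 * (2 * Real.pi)⁻¹ * s ^ 6 := by ring
  have hle := intervalIntegral.norm_integral_le_of_norm_le (μ := volume) (by linarith : -Real.pi ≤ Real.pi)
    (ae_of_all _ hb) (Continuous.intervalIntegrable (by fun_prop) _ _)
  refine hle.trans (le_of_eq ?_)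
  rw [intervalIntegral.integral_const_mul, integral_pow, ha]
  field_simp
  push_cast
  ring

theorem ciApprox_nat_mul_two_pi (n : ℕ) : ciApprox (n * (2 * Real.pi))
    = -(n * (2 * Real.pi))⁻¹ ^ 2 + 6 * (n * (2 * Real.pi))⁻¹ ^ 4 := by
  have hs : Real.sin (n * (2 * Real.pi)) = 0 := by
    have := Real.sin_nat_mul_pi (2 * n); rw [← this]; push_cast; ring_nf
  rw [ciApprox, hs, Real.cos_nat_mul_two_pi]
  ring

/-- The combination of values of `Ci` is expressed through `Ci (4π)`, `Ci (8π)` and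
`Ci (4π) - Ci (2π)`, each of which is known up to a small error. -/
theorem abs_quadCoeff_sub_lt : |quadCoeff - 24.85| < 0.005 := by
  have h1 := abs_le.1 abs_Ci_four_pi_sub_le
  have h2 := abs_le.1 (abs_Ci_sub_le (by positivity : 0 < 4 * Real.pi))
  have h3 := abs_le.1 (abs_Ci_sub_le (by positivity : 0 < 8 * Real.pi))
  have e2 := ciApprox_nat_mul_two_pi 2
  have e3 := ciApprox_nat_mul_two_pi 4
  rw [show ((2 : ℕ) : ℝ) * (2 * Real.pi) = 4 * Real.pi by push_cast; ring, mul_inv] at e2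
  rw [show ((4 : ℕ) : ℝ) * (2 * Real.pi) = 8 * Real.pi by push_cast; ring, mul_inv] at e3
  rw [e2, mul_inv] at h2
  rw [e3, mul_inv] at h3
  have hl : Real.log 8 = 3 * Real.log 2 := by
    rw [show (8 : ℝ) = 2 ^ 3 by norm_num, Real.log_pow]; norm_num
  have hl1 := Real.log_two_gt_d9
  have hl2 := Real.log_two_lt_d9
  have p1 := Real.pi_gt_d6
  have p2 := Real.pi_lt_d6
  have hi1 : 0.3183 < Real.pi⁻¹ := by
    rw [lt_inv_comm₀ (by norm_num) Real.pi_pos]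
    exact p2.trans (by norm_num)
  have hi2 : Real.pi⁻¹ < 0.31832 := by
    rw [inv_lt_comm₀ Real.pi_pos (by norm_num)]
    exact lt_trans (by norm_num) p1
  have hi0 : 0 < Real.pi⁻¹ := inv_pos.2 Real.pi_pos
  have hx1 : 0.3183 ^ 2 < Real.pi⁻¹ ^ 2 := by gcongr
  have hx2 : Real.pi⁻¹ ^ 2 < 0.31832 ^ 2 := by gcongr
  have hy1 : 0.3183 ^ 4 < Real.pi⁻¹ ^ 4 := by gcongr
  have hy2 : Real.pi⁻¹ ^ 4 < 0.31832 ^ 4 := by gcongr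
  have hz1 : 3.141592 ^ 2 < Real.pi ^ 2 := by gcongr
  have hz2 : Real.pi ^ 2 < 3.141593 ^ 2 := by gcongr
  rw [mul_pow, mul_pow] at h2 h3
  obtain ⟨S, hS⟩ : ∃ S, S = 3 * Real.pi ^ 2 + Real.log 8 + 15 / 4 * Ci (2 * Real.pi)
    - 27 / 4 * Ci (4 * Real.pi) + 3 * Ci (8 * Real.pi) := ⟨_, rfl⟩
  rw [hl] at hS
  have hS1 : 31.637 < S := by norm_num at *; linarith [h1.1, h1.2, h2.1, h2.2, h3.1, h3.2]
  have hS2 : S < 31.643 := by norm_num at *; linarith [h1.1, h1.2, h2.1, h2.2, h3.1, h3.2]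
  rw [quadCoeff, hl, ← hS, abs_lt]
  constructor <;> nlinarith

/-! ### The optimal value for `R = 2π` -/

/-- `2 Δ p̄ / β` for `R = 2π`, as a function of the radius. -/
noncomputable def lapProfile (r : ℝ) : ℝ :=
  Real.sin r - 2 * (Real.cos r * r⁻¹) + Real.sin r * r⁻¹ ^ 2 + (Real.cos r - 1) * r⁻¹ ^ 3

theorem lapHat_two_pi (β : ℝ) {r : ℝ} (hr : 0 < r) :
    lapHat (2 * Real.pi) β r = β / 2 * lapProfile r := by
  have hone : 2 * Real.pi / (2 * Real.pi) = 1 := div_self (by positivity)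
  have hp : ∀ s, pHat (2 * Real.pi) β s
      = β / 2 * (-Real.sin s + s⁻¹ * (Real.cos s - 1)) := by
    intro s
    rw [pHat, (hasDerivAt_hHat _ _ _).deriv, hHat, hone]
    ring_nf
  have hd1 : ∀ s, 0 < s → HasDerivAt (pHat (2 * Real.pi) β)
      (β / 2 * (-Real.cos s + (-(s ^ 2)⁻¹ * (Real.cos s - 1) + s⁻¹ * -Real.sin s))) s := by
    intro s hs
    rw [funext hp]
    exact ((Real.hasDerivAt_sin s).neg.add ((hasDerivAt_inv hs.ne').mul
      ((Real.hasDerivAt_cos s).sub_const 1))).const_mul _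
  have he : deriv (pHat (2 * Real.pi) β) =ᶠ[𝓝 r] fun s =>
      β / 2 * (-Real.cos s + (-(s⁻¹ ^ 2) * (Real.cos s - 1) + s⁻¹ * -Real.sin s)) := by
    filter_upwards [Ioi_mem_nhds hr] with s hs
    rw [(hd1 s hs).deriv, inv_pow]
  have hi := hasDerivAt_inv hr.ne'
  have hd2 := ((Real.hasDerivAt_cos r).neg.add (((hi.pow 2).neg.mul
      ((Real.hasDerivAt_cos r).sub_const 1)).add
      (hi.mul (Real.hasDerivAt_sin r).neg))).const_mul (β / 2)
  have hd3 := (hd2.congr_of_eventuallyEq he).deriv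
  rw [lapHat, hd3, (hd1 r hr).deriv, lapProfile]
  simp
  ring

/-- An antiderivative of `r (lapProfile r)²`, up to the two terms that integrate to values of `Ci`. The
negative powers of `r` are removed one after the other by integration by parts. -/
theorem hasDerivAt_mul_lapProfile_sq {r : ℝ} (hr : 0 < r) :
    HasDerivAt (fun r => -(1 / 4) * ((Real.cos r - 1) ^ 2 * r⁻¹ ^ 4)
        - 1 / 2 * (Real.sin r * (Real.cos r - 1) * r⁻¹ ^ 3)
        - 1 / 2 * ((1 / 2 * Real.sin r ^ 2 - 7 / 2 * (Real.cos r ^ 2 - Real.cos r)) * r⁻¹ ^ 2)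
        - (2 * (Real.sin r * Real.cos r) - 15 / 4 * Real.sin r) * r⁻¹
        + (1 / 4 * r ^ 2 - 1 / 2 * (r * (Real.sin r * Real.cos r)) + 1 / 4 * Real.sin r ^ 2)
        - 2 * Real.sin r ^ 2 + 3 * Real.log r)
      (r * lapProfile r ^ 2 - 3 * (Real.cos (2 * r) / r) + 15 / 4 * (Real.cos r / r)) r := by
  have hs := Real.hasDerivAt_sin r
  have hc := Real.hasDerivAt_cos r
  have hi := hasDerivAt_inv hr.ne'
  have hid := hasDerivAt_id r
  have h := ((((((((hc.sub_const 1).pow 2).mul (hi.pow 4)).const_mul (-(1 / 4))).sub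
    (((hs.mul (hc.sub_const 1)).mul (hi.pow 3)).const_mul (1 / 2))).sub
    (((((hs.pow 2).const_mul (1 / 2)).sub (((hc.pow 2).sub hc).const_mul (7 / 2))).mul
      (hi.pow 2)).const_mul (1 / 2))).sub
    ((((hs.mul hc).const_mul 2).sub (hs.const_mul (15 / 4))).mul hi)).add
    ((((hid.pow 2).const_mul (1 / 4)).sub ((hid.mul (hs.mul hc)).const_mul (1 / 2))).add
      ((hs.pow 2).const_mul (1 / 4)))).sub ((hs.pow 2).const_mul 2)
  have h' := h.add ((Real.hasDerivAt_log hr.ne').const_mul 3)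
  convert! h' using 1
  have hcs := Real.sin_sq_add_cos_sq r
  simp only [lapProfile, Real.cos_two_mul']
  simp
  generalize Real.sin r = s at *
  generalize Real.cos r = c at *
  have hri : r * r⁻¹ = 1 := mul_inv_cancel₀ hr.ne'
  simp only [div_eq_mul_inv, ← inv_pow]
  generalize r⁻¹ = i at *
  linear_combination (2 * s * (-2 * c + s * i + (c - 1) * i ^ 2)
    + i * (-2 * c + s * i + (c - 1) * i ^ 2) ^ 2) * hri + (3 * i + r / 2) * hcs

theorem continuousOn_lapProfile : ContinuousOn lapProfile (Ioi 0) := by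
  have hi : ContinuousOn (fun r : ℝ => r⁻¹) (Ioi 0) :=
    continuousOn_inv₀.mono fun r hr => (ne_of_gt hr : r ≠ 0)
  have hs := Real.continuous_sin.continuousOn (s := Ioi (0 : ℝ))
  have hc := Real.continuous_cos.continuousOn (s := Ioi (0 : ℝ))
  exact ((hs.sub (continuousOn_const.mul (hc.mul hi))).add (hs.mul (hi.pow 2))).add
    ((hc.sub continuousOn_const).mul (hi.pow 3))

theorem integral_mul_lapProfile_sq :
    ∫ r in 2 * Real.pi..4 * Real.pi, r * lapProfile r ^ 2
      = 3 * Real.pi ^ 2 + Real.log 8 + 15 / 4 * Ci (2 * Real.pi)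
        - 27 / 4 * Ci (4 * Real.pi) + 3 * Ci (8 * Real.pi) := by
  have hπ := Real.pi_pos
  have hpos : ∀ r ∈ uIcc (2 * Real.pi) (4 * Real.pi), 0 < r := fun r hr => by
    rw [uIcc_of_le (by linarith)] at hr
    linarith [hr.1]
  have i1 : IntervalIntegrable (fun r => r * lapProfile r ^ 2) volume (2 * Real.pi)
      (4 * Real.pi) := (continuousOn_id.mul
        ((continuousOn_lapProfile.mono hpos).pow 2)).intervalIntegrable
  have i2 : IntervalIntegrable (fun r => Real.cos (2 * r) / r) volume (2 * Real.pi)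
      (4 * Real.pi) := ContinuousOn.intervalIntegrable
        ((by fun_prop : Continuous fun r : ℝ => Real.cos (2 * r)).continuousOn.div continuousOn_id
          fun r hr => (hpos r hr).ne')
  have i3 := (continuousOn_cos_div (by positivity : 0 < 2 * Real.pi)
    (by positivity : 0 < 4 * Real.pi)).intervalIntegrable (μ := volume)
  have h := intervalIntegral.integral_eq_sub_of_hasDerivAt
    (fun r hr => hasDerivAt_mul_lapProfile_sq (hpos r hr))
    ((i1.sub (i2.const_mul 3)).add (i3.const_mul (15 / 4)))
  have e4c : Real.cos (4 * Real.pi) = 1 := by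
    rw [show 4 * Real.pi = 2 * Real.pi + 2 * Real.pi by ring, Real.cos_add_two_pi,
      Real.cos_two_pi]
  have e4s : Real.sin (4 * Real.pi) = 0 := by
    rw [show 4 * Real.pi = 2 * Real.pi + 2 * Real.pi by ring, Real.sin_add_two_pi,
      Real.sin_two_pi]
  have hdouble : ∫ r in 2 * Real.pi..4 * Real.pi, Real.cos (2 * r) / r
      = Ci (8 * Real.pi) - Ci (4 * Real.pi) := by
    rw [← integral_cos_div_eq_Ci_sub (by positivity) (by positivity)]
    have hc := intervalIntegral.integral_comp_mul_left (a := 2 * Real.pi) (b := 4 * Real.pi)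
      (fun τ => Real.cos τ / τ) (two_ne_zero (α := ℝ))
    rw [show 2 * (2 * Real.pi) = 4 * Real.pi by ring, show 2 * (4 * Real.pi) = 8 * Real.pi by ring,
      smul_eq_mul, inv_mul_eq_div, eq_div_iff two_ne_zero] at hc
    rw [← hc, ← intervalIntegral.integral_mul_const]
    refine intervalIntegral.integral_congr fun r hr => ?_
    have := (hpos r hr).ne'
    field_simp
  rw [intervalIntegral.integral_add (i1.sub (i2.const_mul 3)) (i3.const_mul _),
    intervalIntegral.integral_sub i1 (i2.const_mul 3), intervalIntegral.integral_const_mul,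
    intervalIntegral.integral_const_mul, hdouble,
    integral_cos_div_eq_Ci_sub (by positivity) (by positivity)] at h
  simp only [e4c, e4s, Real.cos_two_pi, Real.sin_two_pi] at h
  have hl : Real.log (4 * Real.pi) = Real.log 2 + Real.log (2 * Real.pi) := by
    rw [← Real.log_mul (by norm_num) (by positivity)]
    ring_nf
  have hl8 : Real.log 8 = 3 * Real.log 2 := by
    rw [show (8 : ℝ) = 2 ^ 3 by norm_num, Real.log_pow]; norm_num
  rw [hl] at h
  rw [hl8]
  linarith

/-- Integration of radial functions over the annulus. -/
theorem integral_annulus_radial {R : ℝ} (hR : 0 < R) (f : ℝ → ℝ) :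
    ∫ x in annulus R, f ‖x‖ = 2 * Real.pi * ∫ r in R..2 * R, r * f r := by
  have hball : volume.real (Metric.ball (0 : EuclideanSpace ℝ (Fin 2)) 1) = Real.pi := by
    rw [measureReal_def, EuclideanSpace.volume_ball_fin_two]
    simp [Real.pi_pos.le]
  have h := integral_fun_norm_addHaar (volume : Measure (EuclideanSpace ℝ (Fin 2)))
    ((Ioo R (2 * R)).indicator f)
  rw [finrank_euclideanSpace_fin, hball] at h
  rw [← integral_indicator (isOpen_annulus R).measurableSet,
    intervalIntegral.integral_of_le (by linarith), integral_Ioc_eq_integral_Ioo]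
  have e1 : (fun x : EuclideanSpace ℝ (Fin 2) => (Ioo R (2 * R)).indicator f ‖x‖)
      = (annulus R).indicator fun x => f ‖x‖ := by
    funext x
    by_cases hx : x ∈ annulus R
    · rw [indicator_of_mem hx, indicator_of_mem (mem_annulus.1 hx)]
    · rw [indicator_of_notMem hx, indicator_of_notMem fun h => hx (mem_annulus.2 h)]
  have e2 : (fun r : ℝ => r ^ (2 - 1) • (Ioo R (2 * R)).indicator f r)
      = (Ioo R (2 * R)).indicator fun r => r * f r := by
    funext r
    by_cases hr : r ∈ Ioo R (2 * R) <;> simp [hr]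
  have e3 : Ioi (0 : ℝ) ∩ Ioo R (2 * R) = Ioo R (2 * R) :=
    inter_eq_right.2 fun r hr => hR.trans hr.1
  rw [e1, e2, setIntegral_indicator measurableSet_Ioo, e3] at h
  rw [h]
  simp
  ring

theorem objective_bar_eq (R β : ℝ) :
    objective (annulus R) (yDesired R β) β (yBar R) (uBar R) =
      1 / 2 * (∫ x in annulus R, (Laplacian.laplacian (pBar R β) x) ^ 2)
        + β * (tvSeminorm (annulus R) (uBar R)).toReal := by
  unfold objective yDesired
  congr 3
  funext x
  ring

theorem objective_two_pi {β : ℝ} (hβ : 0 < β) :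
    objective (annulus (2 * Real.pi)) (yDesired (2 * Real.pi) β) β
        (yBar (2 * Real.pi)) (uBar (2 * Real.pi)) =
      quadCoeff * β ^ 2 + 6 * Real.pi ^ 2 * β := by
  have hR : 0 < 2 * Real.pi := by positivity
  have h1 : ∫ x in annulus (2 * Real.pi), (Laplacian.laplacian (pBar (2 * Real.pi) β) x) ^ 2
      = ∫ x in annulus (2 * Real.pi), (fun r => β ^ 2 / 4 * lapProfile r ^ 2) ‖x‖ :=
    setIntegral_congr_fun (isOpen_annulus _).measurableSet fun x hx => by
      have h0 := ne_zero_of_norm_mem_Icc hR (norm_mem_Icc hx)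
      simp only [laplacian_pBar h0, lapHat_two_pi β (norm_pos_iff.2 h0)]
      ring
  have h2 : ∫ r in 2 * Real.pi..2 * (2 * Real.pi), r * (fun r => β ^ 2 / 4 * lapProfile r ^ 2) r
      = β ^ 2 / 4 * ∫ r in 2 * Real.pi..4 * Real.pi, r * lapProfile r ^ 2 := by
    rw [← intervalIntegral.integral_const_mul, show 2 * (2 * Real.pi) = 4 * Real.pi by ring]
    congr 1
    funext r
    ring
  rw [objective_bar_eq, h1, integral_annulus_radial hR (fun r => β ^ 2 / 4 * lapProfile r ^ 2), h2, integral_mul_lapProfile_sq,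
    (integral_uBar_mul_pBar hR hβ).1, ENNReal.toReal_ofReal (by positivity), quadCoeff]
  ring

end AnnulusControl

theorem mainTheorem10 (R β : ℝ) (hR : 0 < R) (hβ : 0 < β) :
    -- the adjoint state `p̄ = div h̄`: classical, radial, zero on the boundary
    ((∀ x ∈ closure (annulus R), ContDiffAt ℝ ∞ (hBar R β) x ∧ ContDiffAt ℝ ∞ (pBar R β) x ∧
        pBar R β x = deriv (hHat R β) (radius x) + (radius x)⁻¹ * hHat R β (radius x)) ∧
      (∀ x ∈ frontier (annulus R), pBar R β x = 0)) ∧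
    -- the explicit state: `C¹`, zero on the boundary, and the unique weak solution `ȳ = S ū`
    (ContDiffOn ℝ 1 (yBar R) (annulus R) ∧ ContinuousOn (yBar R) (closure (annulus R)) ∧
      (∀ x ∈ frontier (annulus R), yBar R x = 0) ∧
      IsWeakSolution (annulus R) (uBar R) (yBar R) ∧
      (∀ y : EuclideanSpace ℝ (Fin 2) → ℝ, IsWeakSolution (annulus R) (uBar R) y →
        y =ᵐ[volume.restrict (annulus R)] yBar R)) ∧
    -- `y_Ω ∈ L²(Ω)`, and `p̄` is the adjoint state: `-Δ p̄ = ȳ - y_Ω` weakly, uniquely in `H¹₀`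
    (MemLp (yDesired R β) 2 (volume.restrict (annulus R)) ∧
      IsWeakSolution (annulus R) (fun x => yBar R x - yDesired R β x) (pBar R β) ∧
      (∀ p : EuclideanSpace ℝ (Fin 2) → ℝ,
        IsWeakSolution (annulus R) (fun x => yBar R x - yDesired R β x) p →
        p =ᵐ[volume.restrict (annulus R)] pBar R β)) ∧
    -- the first-order optimality conditions: `h̄ ∈ L^∞ ∩ W₀^q(div)`, `|h̄| ≤ β`, the measure `∇ū`
    -- is `-∇r` times the arc length on the circle `r = 3R/2`, and `h̄ = -β ∇r` there
    ((∀ q : ENNReal, 1 ≤ q → q < ⊤ → IsW0Div q (annulus R) (hBar R β) (pBar R β)) ∧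
      (∀ x ∈ frontier (annulus R), hBar R β x = 0) ∧
      (∀ x ∈ annulus R, ‖hBar R β x‖ ≤ β) ∧
      (∀ v : EuclideanSpace ℝ (Fin 2) → EuclideanSpace ℝ (Fin 2), IsTest 1 (annulus R) v →
        ∫ x in annulus R, uBar R x * divergence v x =
          ∫ θ in (0 : ℝ)..2 * Real.pi, 3 * R / 2 *
            inner ℝ (v (circlePoint (3 * R / 2) θ))
              (gradient radius (circlePoint (3 * R / 2) θ))) ∧
      (∀ x, radius x = 3 * R / 2 → hBar R β x = -β • gradient radius x)) ∧
    -- `(ȳ, ū)` is the unique solution of the optimal control problem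
    (IsOptimal (annulus R) (yDesired R β) β (yBar R) (uBar R) ∧
      (∀ y u : EuclideanSpace ℝ (Fin 2) → ℝ, IsOptimal (annulus R) (yDesired R β) β y u →
        y =ᵐ[volume.restrict (annulus R)] yBar R ∧
        u =ᵐ[volume.restrict (annulus R)] uBar R)) ∧
    -- the optimal value for general `R`
    objective (annulus R) (yDesired R β) β (yBar R) (uBar R) =
      1 / 2 * (∫ x in annulus R, (Laplacian.laplacian (pBar R β) x) ^ 2)
        + β * (tvSeminorm (annulus R) (uBar R)).toReal ∧
    -- the optimal value for `R = 2π`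
    ((∀ t : ℝ, 0 < t →
        Tendsto (fun T : ℝ => -∫ τ in t..T, Real.cos τ / τ) atTop (𝓝 (Ci t))) ∧
      objective (annulus (2 * Real.pi)) (yDesired (2 * Real.pi) β) β
          (yBar (2 * Real.pi)) (uBar (2 * Real.pi)) =
        quadCoeff * β ^ 2 + 6 * Real.pi ^ 2 * β ∧
      |quadCoeff - 24.85| < 0.005 ∧ |6 * Real.pi ^ 2 - 59.22| < 0.005) := by
  have hN : 0 < 2 := two_pos
  have hΩ := isOpen_annulus R
  have h0 : ∀ x ∈ closure (annulus R), x ≠ 0 := fun x hx =>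
    ne_zero_of_norm_mem_Icc hR (norm_mem_of_mem_closure_annulus hx)
  have h0' : ∀ x ∈ frontier (annulus R), x ≠ 0 := fun x hx => h0 x (frontier_subset_closure hx)
  refine ⟨⟨fun x hx => ⟨contDiffAt_hBar (h0 x hx), contDiffAt_pBar (h0 x hx), pBar_eq (h0 x hx)⟩,
      fun x hx => ?_⟩,
    ⟨fun x hx => ?_, fun x hx => ?_, fun x hx => ?_, isWeakSolution_yBar hR, fun y hy =>
      hy.ae_eq hN hΩ (annulus_subset_ball R) (isWeakSolution_yBar hR)⟩,
    ⟨memLp_yDesired hR β, isWeakSolution_pBar hR β, fun p hp =>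
      hp.ae_eq hN hΩ (annulus_subset_ball R) (isWeakSolution_pBar hR β)⟩,
    ⟨fun q hq hq' => isW0Div_hBar hR β hq hq', fun x hx => ?_, fun x _ => ?_,
      fun v hv => integral_uBar_mul_divergence hR hv, fun x hx => ?_⟩,
    isOptimal_bar hR hβ, objective_bar_eq R β,
    fun t ht => tendsto_Ci ht, objective_two_pi hβ, abs_quadCoeff_sub_lt, ?_⟩
  · rw [pBar_eq (h0' x hx)]
    rcases norm_eq_of_mem_frontier_annulus hx with h | h <;> rw [h]
    exacts [pHat_left hR β, pHat_right hR β]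
  · have hx0 := h0 x (subset_closure hx)
    exact ((contDiffAt_yHat hR (norm_pos_iff.2 hx0)).comp x
      (contDiffAt_norm ℝ hx0)).contDiffWithinAt
  · have hx0 := h0 x hx
    exact ((contDiffAt_yHat hR (norm_pos_iff.2 hx0)).comp x
      (contDiffAt_norm ℝ hx0)).continuousAt.continuousWithinAt
  · rw [yBar, radius]
    rcases norm_eq_of_mem_frontier_annulus hx with h | h <;> rw [h]
    exacts [yHat_left hR, yHat_right hR]
  · rw [hBar, radius]
    rcases norm_eq_of_mem_frontier_annulus hx with h | h <;> rw [h]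
    · rw [hHat_left hR, zero_smul]
    · rw [hHat_right hR, zero_smul]
  · rw [hBar, norm_smul]
    exact (mul_le_mul (abs_hHat_le R hβ _) (norm_gradient_radius_le x) (norm_nonneg _)
      hβ.le).trans (mul_one β).le
  · rw [hBar, hx, hHat_mid hR]
  · have h1 := Real.pi_gt_d6
    have h2 := Real.pi_lt_d6
    rw [abs_lt]
    constructor <;> nlinarith
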